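/- **Twisted convolution and the Grönewold–Moyal product for the Weyl system.** Let $U(q,p)=\exp(i(p\hat q-q\hat p))=e^{-\frac i2 qp}e^{ip\hat q}e^{-iq\hat p}$, i.e. $(U(q,p)\varphi)(x)=e^{-\frac i2 qp}e^{ipx}\varphi(x-q)$, be the Weyl system in $L^2(\mathbb R)$. Equip $\mathbb R\times\mathbb R$ with the Haar measure $(2\pi)^{-1}dq\,dp$, write $L^2(\mathbb R\times\mathbb R)=L^2(\mathbb R\times\mathbb R,(2\pi)^{-1}dq\,dp;\mathbb C)$, and let inner products be antilinear in the first argument. Let $\mathcal B_2$ be the Hilbert space of Hilbert–Schmidt operators in $L^2(\mathbb R)$. Then: 1. Each $U(q,p)$ is unitary, $U(q+q',p+p')=e^{\frac i2(qp'-pq')}U(q,p)U(q',p')$, and the coefficients $c_{\psi,\varphi}(q,p)=\langle U(q,p)\psi,\varphi\rangle$ are square integrable with $\frac1{2\pi}\int \overline{c_{\psi_1,\varphi_1}}\,c_{\psi_2,\varphi_2}\,dq\,dp=\langle\varphi_1,\varphi_2\rangle\langle\psi_2,\psi_1\rangle$ for all $\varphi_1,\varphi_2,\psi_1,\psi_2\in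 L^2(\mathbb R)$. 2. There is a unique bounded linear map $\mathfrak S_U\colon\mathcal B_2\to L^2(\mathbb R\times\mathbb R)$ (the Wigner transform of $U$) with $\big(\mathfrak S_U|\varphi\rangle\langle\psi|\big)(q,p)=\mathrm{tr}\big(U(q,p)^*|\varphi\rangle\langle\psi|\big)=\langle U(q,p)\psi,\varphi\rangle$ for almost all $(q,p)$ and all $\varphi,\psi\in L^2(\mathbb R)$. It is an isometry and $\mathrm{Ran}(\mathfrak S_U)=L^2(\mathbb R\times\mathbb R)$. 3. There is a unique bounded linear operator $\mathcal F$ in $L^2(\mathbb R\times\mathbb R)$ (the symplectic Fourier transform) with $(\mathcal Ff)(q,p)=\frac1{2\pi}\int f(q',p')e^{i(qp'-pq')}dq'dp'$ for almost all $(q,p)$ and all $f\in L^1\cap L^2$; it is unitary and selfadjoint. 4. The star product $f_1\star f_2:=\mathfrak S_U\big((\mathfrak S_U^*f_1)(\mathfrak S_U^*f_2)\big)$ is the twisted convolution: for all $f_1,f_2\in L^2(\mathbb R\times\mathbb R)$ and almost all $(q,p)$, $$(f_1\star f_2)(q,p)=\frac1{2\pi}\int f_1(q',p')\,f_2(q-q',p-p')\,e^{\frac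 i2(qp'-pq')}\,dq'dp',$$ where the integral converges absolutely for every $(q,p)$. 5. Let $\mathfrak T=\mathcal F\,\mathfrak S_U$ be the standard Wigner transform. The twisted product $f_1\circledast f_2:=\mathfrak T\big((\mathfrak T^*f_1)(\mathfrak T^*f_2)\big)$ satisfies $f_1\circledast f_2=\mathcal F\big((\mathcal Ff_1)\star(\mathcal Ff_2)\big)$ for all $f_1,f_2\in L^2(\mathbb R\times\mathbb R)$, and for all $f_1,f_2\in L^1\cap L^2$ and almost all $(q,p)$, $$(f_1\circledast f_2)(q,p)=\frac1{\pi^2}\int dq'dp'\int dq''dp''\;\theta(q,p;q',p';q'',p'')\,f_1(q',p')\,f_2(q'',p''),$$ with the Grönewold–Moyal kernel $\theta(q,p;q',p';q'',p'')=\exp\big(2i(qp'-pq'+q'p''-p'q''+q''p-p''q)\big)$; for every $(q,p)$ the double integral converges absolutely. -/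

import Mathlib

open MeasureTheory Complex
open scoped InnerProductSpace ENNReal

/-! ### Hilbert-Schmidt operators -/

noncomputable section HilbertSchmidtOperators

/-- The index set of a Hilbert basis (complete orthonormal system) of `H`. -/
def HSIndex (H : Type*) [NormedAddCommGroup H] [InnerProductSpace ℂ H] [CompleteSpace H] : Set H :=
  (exists_hilbertBasis ℂ H).choose

/-- A Hilbert basis of `H`.  Nothing below depends on which one is taken, see
`HilbertSchmidt.hasSum_norm_sq` and `HilbertSchmidt.hasSum_inner`. -/
def hsBasis (H : Type*) [NormedAddCommGroup H] [InnerProductSpace ℂ H] [CompleteSpace H] :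
    HilbertBasis (HSIndex H) ℂ H :=
  (exists_hilbertBasis ℂ H).choose_spec.choose

theorem enorm_sq_eq_tsum_inner {H : Type*} [NormedAddCommGroup H] [InnerProductSpace ℂ H]
    {ι : Type*} (b : HilbertBasis ι ℂ H) (x : H) :
    ‖x‖ₑ ^ 2 = ∑' i, ‖⟪b i, x⟫_ℂ‖ₑ ^ 2 := by
  have h : HasSum (fun i => ‖⟪b i, x⟫_ℂ‖ ^ 2) (‖x‖ ^ 2) := by
    have h1 := b.hasSum_inner_mul_inner x x
    have h2 := (Complex.hasSum_re h1)
    have h3 : (⟪x, x⟫_ℂ).re = ‖x‖ ^ 2 := by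
      simpa using inner_self_eq_norm_sq (𝕜 := ℂ) x
    rw [h3] at h2
    convert h2 using 2 with i
    rw [← inner_conj_symm x (b i), ← Complex.normSq_eq_norm_sq, ← Complex.normSq_eq_conj_mul_self]
    simp
  have h4 : ENNReal.ofReal (‖x‖ ^ 2) = ∑' i, ENNReal.ofReal (‖⟪b i, x⟫_ℂ‖ ^ 2) := by
    rw [← h.tsum_eq, ENNReal.ofReal_tsum_of_nonneg (fun i => by positivity) h.summable]
  simpa [ENNReal.ofReal_pow] using h4

theorem summable_norm_sq_iff {H : Type*} [NormedAddCommGroup H] {ι : Type*} (b : ι → H) :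
    Summable (fun i => ‖b i‖ ^ 2) ↔ ∑' i, ‖b i‖ₑ ^ 2 ≠ ∞ := by
  have h : ∀ i, ‖b i‖ₑ ^ 2 = ((‖b i‖₊ ^ 2 : NNReal) : ℝ≥0∞) := fun i => by
    simp [enorm_eq_nnnorm]
  simp_rw [h]
  rw [ENNReal.tsum_coe_ne_top_iff_summable, ← NNReal.summable_coe]
  simp

theorem tsum_norm_sq_eq_toReal {H : Type*} [NormedAddCommGroup H] {ι : Type*} (b : ι → H) :
    ∑' i, ‖b i‖ ^ 2 = (∑' i, ‖b i‖ₑ ^ 2).toReal := by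
  rw [ENNReal.tsum_toReal_eq (fun i => by simp)]
  simp

variable {H : Type*} [NormedAddCommGroup H] [InnerProductSpace ℂ H] [CompleteSpace H]

theorem tsum_enorm_sq_eq_adjoint {ι κ : Type*} (b : HilbertBasis ι ℂ H) (c : HilbertBasis κ ℂ H)
    (A : H →L[ℂ] H) :
    ∑' i, ‖A (b i)‖ₑ ^ 2 = ∑' j, ‖ContinuousLinearMap.adjoint A (c j)‖ₑ ^ 2 := by
  simp_rw [enorm_sq_eq_tsum_inner c (A (b _)), enorm_sq_eq_tsum_inner b
    (ContinuousLinearMap.adjoint A (c _))]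
  rw [ENNReal.tsum_comm]
  refine tsum_congr fun j => tsum_congr fun i => ?_
  rw [ContinuousLinearMap.adjoint_inner_right, ← inner_conj_symm, ← ofReal_norm, ← ofReal_norm,
    RCLike.norm_conj]

theorem tsum_enorm_sq_eq {ι κ : Type*} (b : HilbertBasis ι ℂ H) (c : HilbertBasis κ ℂ H)
    (A : H →L[ℂ] H) : ∑' i, ‖A (b i)‖ₑ ^ 2 = ∑' j, ‖A (c j)‖ₑ ^ 2 := by
  rw [tsum_enorm_sq_eq_adjoint b b, tsum_enorm_sq_eq_adjoint c b]

/-- The Hilbert-Schmidt operators, as a linear subspace of the bounded operators: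
`∑ ‖A eᵢ‖² < ∞` for a Hilbert basis `(eᵢ)`. -/
def hsSubmodule (H : Type*) [NormedAddCommGroup H] [InnerProductSpace ℂ H] [CompleteSpace H] :
    Submodule ℂ (H →L[ℂ] H) where
  carrier := {A | Summable fun i => ‖A (hsBasis H i)‖ ^ 2}
  zero_mem' := by simp [summable_zero]
  add_mem' := by
    intro A B hA hB
    refine Summable.of_nonneg_of_le (fun i => by positivity) (fun i => ?_)
      ((hA.add hB).mul_left 2)
    have h1 : ‖(A + B) (hsBasis H i)‖ ≤ ‖A (hsBasis H i)‖ + ‖B (hsBasis H i)‖ := norm_add_le _ _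
    nlinarith [sq_nonneg (‖A (hsBasis H i)‖ - ‖B (hsBasis H i)‖),
      norm_nonneg ((A + B) (hsBasis H i))]
  smul_mem' := by
    intro c A hA
    have h := Summable.mul_left (‖c‖ ^ 2) hA
    refine h.congr fun i => ?_
    simp [norm_smul, mul_pow]

/-- The space `𝓑₂(H)` of Hilbert-Schmidt operators in `H`.  It carries the Hilbert-Schmidt
inner product (below), not the operator norm. -/
def HilbertSchmidt (H : Type*) [NormedAddCommGroup H] [InnerProductSpace ℂ H] [CompleteSpace H] :
    Type _ :=
  hsSubmodule H

namespace HilbertSchmidt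

instance : AddCommGroup (HilbertSchmidt H) := inferInstanceAs (AddCommGroup (hsSubmodule H))

instance : Module ℂ (HilbertSchmidt H) := inferInstanceAs (Module ℂ (hsSubmodule H))

/-- The bounded operator underlying a Hilbert-Schmidt operator. -/
def toCLM : HilbertSchmidt H →ₗ[ℂ] (H →L[ℂ] H) := (hsSubmodule H).subtype

theorem toCLM_injective : Function.Injective (toCLM : HilbertSchmidt H →ₗ[ℂ] (H →L[ℂ] H)) :=
  Subtype.val_injective

theorem summable_norm_sq {ι : Type*} (b : HilbertBasis ι ℂ H) (A : HilbertSchmidt H) :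
    Summable fun i => ‖toCLM A (b i)‖ ^ 2 := by
  have h : Summable fun i => ‖toCLM A (hsBasis H i)‖ ^ 2 := A.2
  rw [summable_norm_sq_iff] at h ⊢
  rwa [tsum_enorm_sq_eq b (hsBasis H)]

/-- A bounded operator with `∑ ‖A eᵢ‖² < ∞` for some Hilbert basis `(eᵢ)`, as an element
of `𝓑₂(H)`. -/
def mk {ι : Type*} (b : HilbertBasis ι ℂ H) (A : H →L[ℂ] H)
    (hA : Summable fun i => ‖A (b i)‖ ^ 2) : HilbertSchmidt H :=
  ⟨A, by
    change Summable _
    rw [summable_norm_sq_iff] at hA ⊢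
    rwa [tsum_enorm_sq_eq (hsBasis H) b]⟩

@[simp] theorem toCLM_mk {ι : Type*} (b : HilbertBasis ι ℂ H) (A : H →L[ℂ] H)
    (hA : Summable fun i => ‖A (b i)‖ ^ 2) : toCLM (mk b A hA) = A := rfl

/-- The family `(A eᵢ)ᵢ` as an element of the Hilbert sum `ℓ²(H)`. -/
def coeff : HilbertSchmidt H →ₗ[ℂ] lp (fun _ : HSIndex H => H) 2 where
  toFun A := ⟨fun i => toCLM A (hsBasis H i), by
    refine memℓp_gen ?_
    simpa using summable_norm_sq (hsBasis H) A⟩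
  map_add' A B := by ext i; simp; rfl
  map_smul' c A := by ext i; simp

theorem coeff_apply (A : HilbertSchmidt H) (i : HSIndex H) :
    coeff A i = toCLM A (hsBasis H i) := rfl

theorem coeff_injective : Function.Injective (coeff : HilbertSchmidt H → _) := by
  intro A B h
  apply toCLM_injective
  refine ContinuousLinearMap.ext_on (s := Set.range (hsBasis H)) ?_ ?_
  · have := (hsBasis H).dense_span
    rw [dense_iff_closure_eq, ← Submodule.topologicalClosure_coe, this]
    rfl
  · rintro _ ⟨i, rfl⟩
    rw [← coeff_apply, ← coeff_apply, h]

instance : NormedAddCommGroup (HilbertSchmidt H) :=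
  NormedAddCommGroup.induced _ _ (coeff : HilbertSchmidt H →ₗ[ℂ] _) coeff_injective

theorem norm_coeff (A : HilbertSchmidt H) : ‖coeff A‖ = ‖A‖ := rfl

/-- The Hilbert-Schmidt inner product `⟪A, B⟫ = ∑ ⟪A eᵢ, B eᵢ⟫`. -/
instance : InnerProductSpace ℂ (HilbertSchmidt H) where
  norm_smul_le c A := by
    rw [← norm_coeff, ← norm_coeff, map_smul]
    exact norm_smul_le _ _
  inner A B := ∑' i, ⟪toCLM A (hsBasis H i), toCLM B (hsBasis H i)⟫_ℂ
  norm_sq_eq_re_inner A := by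
    rw [← norm_coeff, norm_sq_eq_re_inner (𝕜 := ℂ), lp.inner_eq_tsum]
    rfl
  conj_inner_symm A B := by
    have := inner_conj_symm (𝕜 := ℂ) (coeff A) (coeff B)
    rw [lp.inner_eq_tsum, lp.inner_eq_tsum] at this
    exact this
  add_left A B C := by
    have := inner_add_left (𝕜 := ℂ) (coeff A) (coeff B) (coeff C)
    rw [← map_add, lp.inner_eq_tsum, lp.inner_eq_tsum, lp.inner_eq_tsum] at this
    exact this
  smul_left A B c := by
    have := inner_smul_left (𝕜 := ℂ) (coeff A) (coeff B) c
    rw [← map_smul, lp.inner_eq_tsum, lp.inner_eq_tsum] at this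
    exact this

theorem hasSum_norm_sq {ι : Type*} (b : HilbertBasis ι ℂ H) (A : HilbertSchmidt H) :
    HasSum (fun i => ‖toCLM A (b i)‖ ^ 2) (‖A‖ ^ 2) := by
  have h1 : ‖A‖ ^ 2 = ∑' i, ‖toCLM A (hsBasis H i)‖ ^ 2 := by
    have := lp.norm_rpow_eq_tsum (p := 2) (by simp) (coeff A)
    simpa [norm_coeff, coeff_apply] using this
  have h2 : ∑' i, ‖toCLM A (b i)‖ ^ 2 = ∑' i, ‖toCLM A (hsBasis H i)‖ ^ 2 := by
    rw [tsum_norm_sq_eq_toReal, tsum_norm_sq_eq_toReal, tsum_enorm_sq_eq b (hsBasis H)]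
  rw [h1, ← h2]
  exact (summable_norm_sq b A).hasSum

theorem hasSum_inner {ι : Type*} (b : HilbertBasis ι ℂ H) (A B : HilbertSchmidt H) :
    HasSum (fun i => ⟪toCLM A (b i), toCLM B (b i)⟫_ℂ) ⟪A, B⟫_ℂ := by
  have h := fun C => Complex.hasSum_ofReal.2 (hasSum_norm_sq b C)
  simp_rw [inner_eq_sum_norm_sq_div_four]
  have := (((h (A + B)).sub (h (A - B))).add
    (((h (A - (I : ℂ) • B)).sub (h (A + (I : ℂ) • B))).mul_right (I : ℂ))).div_const 4
  simpa using this

theorem coeff_surjective : Function.Surjective (coeff : HilbertSchmidt H → _) := by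
  intro v
  have hv : Summable fun i => ‖v i‖ ^ (2 : ℝ) := by
    simpa using (lp.memℓp v).summable (by simp)
  have hx : ∀ x : H, HasSum (fun i => ‖⟪hsBasis H i, x⟫_ℂ‖ ^ (2 : ℝ)) (‖x‖ ^ 2) := fun x => by
    have h1 : Summable fun i => ‖⟪hsBasis H i, x⟫_ℂ‖ ^ 2 := by
      rw [summable_norm_sq_iff, ← enorm_sq_eq_tsum_inner]
      simp
    have h2 : ∑' i, ‖⟪hsBasis H i, x⟫_ℂ‖ ^ 2 = ‖x‖ ^ 2 := by
      rw [tsum_norm_sq_eq_toReal, ← enorm_sq_eq_tsum_inner]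
      simp
    simpa [h2] using h1.hasSum
  have hH := fun x : H => Real.inner_le_Lp_mul_Lq_tsum_of_nonneg Real.HolderConjugate.two_two
    (fun i => norm_nonneg ⟪hsBasis H i, x⟫_ℂ) (fun i => norm_nonneg (v i)) (hx x).summable hv
  have hs : ∀ x : H, Summable fun i => ⟪hsBasis H i, x⟫_ℂ • v i := fun x =>
    Summable.of_norm (by simpa [norm_smul] using (Real.summable_mul_of_Lp_Lq_of_nonneg Real.HolderConjugate.two_two
      (fun i => norm_nonneg ⟪hsBasis H i, x⟫_ℂ) (fun i => norm_nonneg (v i)) (hx x).summable hv))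
  let L : H →ₗ[ℂ] H :=
    { toFun := fun x => ∑' i, ⟪hsBasis H i, x⟫_ℂ • v i
      map_add' := fun x y => by
        rw [← (hs x).tsum_add (hs y)]
        simp [add_smul]
      map_smul' := fun c x => by
        simp only [inner_smul_right, mul_smul, RingHom.id_apply]
        exact (hs x).tsum_const_smul c }
  let A : H →L[ℂ] H := L.mkContinuous ((∑' i, ‖v i‖ ^ (2 : ℝ)) ^ (1 / (2 : ℝ))) fun x => by
    refine (norm_tsum_le_tsum_norm ?_).trans ?_
    · simpa [norm_smul] using (Real.summable_mul_of_Lp_Lq_of_nonneg Real.HolderConjugate.two_two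
      (fun i => norm_nonneg ⟪hsBasis H i, x⟫_ℂ) (fun i => norm_nonneg (v i)) (hx x).summable hv)
    · have h := hH x
      rw [(hx x).tsum_eq, ← Real.sqrt_eq_rpow (‖x‖ ^ 2), Real.sqrt_sq (norm_nonneg x)] at h
      simpa [norm_smul, mul_comm] using h
  have hA : ∀ i, A (hsBasis H i) = v i := fun i => by
    change ∑' j, ⟪hsBasis H j, hsBasis H i⟫_ℂ • v j = v i
    rw [tsum_eq_single i]
    · simp [(hsBasis H).orthonormal.1 i]
    · intro j hj
      rw [(hsBasis H).orthonormal.2 hj, zero_smul]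
  refine ⟨mk (hsBasis H) A ?_, ?_⟩
  · simpa [hA] using hv
  · ext i
    rw [coeff_apply, toCLM_mk, hA]

instance : CompleteSpace (HilbertSchmidt H) := by
  let e : HilbertSchmidt H ≃ₗᵢ[ℂ] lp (fun _ : HSIndex H => H) 2 :=
    LinearIsometryEquiv.ofSurjective ⟨coeff, norm_coeff⟩ coeff_surjective
  exact (completeSpace_congr (e := e.toEquiv)
    e.isometry.isUniformInducing.isUniformEmbedding).2 inferInstance

/-- The product (composition) `A B` of two Hilbert-Schmidt operators. -/
def comp (A B : HilbertSchmidt H) : HilbertSchmidt H :=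
  mk (hsBasis H) (toCLM A ∘L toCLM B) (by
    refine Summable.of_nonneg_of_le (fun i => by positivity) (fun i => ?_)
      ((summable_norm_sq (hsBasis H) B).mul_left (‖toCLM A‖ ^ 2))
    rw [← mul_pow]
    gcongr
    exact (toCLM A).le_opNorm _)

/-- The rank one operator `|φ⟩⟨ψ| : χ ↦ ⟪ψ, χ⟫ φ`. -/
def rankOne (φ ψ : H) : HilbertSchmidt H :=
  mk (hsBasis H) (InnerProductSpace.rankOne ℂ φ ψ) (by
    have h : Summable fun i => ‖⟪hsBasis H i, ψ⟫_ℂ‖ ^ 2 := by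
      rw [summable_norm_sq_iff, ← enorm_sq_eq_tsum_inner]
      simp
    refine (h.mul_right (‖φ‖ ^ 2)).congr fun i => ?_
    rw [InnerProductSpace.rankOne_apply, norm_smul, mul_pow, norm_inner_symm])

end HilbertSchmidt

end HilbertSchmidtOperators

/-! ### The Weyl system and its star products -/

noncomputable section Weyl

/-- The configuration Hilbert space `L²(ℝ)`. -/
abbrev ConfL2 : Type := Lp ℂ 2 (volume : Measure ℝ)

/-- The Haar measure `(2π)⁻¹ dq dp` on phase space `ℝ × ℝ`. -/
def phaseMeasure : Measure (ℝ × ℝ) := ENNReal.ofReal (2 * Real.pi)⁻¹ • volume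

/-- `L²(ℝ × ℝ) = L²(ℝ × ℝ, (2π)⁻¹ dq dp; ℂ)`. -/
abbrev PhaseL2 : Type := Lp ℂ 2 phaseMeasure

theorem memLp_modulation (p : ℝ) (φ : ConfL2) :
    MemLp (fun x : ℝ => cexp (I * (p * x : ℝ)) * φ x) 2 volume := by
  refine (Lp.memLp φ).of_le ?_ (Filter.Eventually.of_forall fun x => ?_)
  · exact (by fun_prop : Continuous fun x : ℝ => cexp (I * (p * x : ℝ))).aestronglyMeasurable.mul
      (Lp.aestronglyMeasurable φ)
  · rw [norm_mul, mul_comm I, Complex.norm_exp_ofReal_mul_I, one_mul]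

/-- The operator `exp (i p q̂)` of multiplication by `x ↦ e^{ipx}` in `L²(ℝ)`. -/
def expPosition (p : ℝ) : ConfL2 →ₗᵢ[ℂ] ConfL2 where
  toFun φ := (memLp_modulation p φ).toLp
  map_add' φ ψ := by
    refine Lp.ext ?_
    filter_upwards [(memLp_modulation p (φ + ψ)).coeFn_toLp, (memLp_modulation p φ).coeFn_toLp,
      (memLp_modulation p ψ).coeFn_toLp, Lp.coeFn_add φ ψ,
      Lp.coeFn_add (memLp_modulation p φ).toLp (memLp_modulation p ψ).toLp] with x h1 h2 h3 h4 h5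
    rw [h1, h5, Pi.add_apply, h2, h3, h4, Pi.add_apply, mul_add]
  map_smul' c φ := by
    refine Lp.ext ?_
    filter_upwards [(memLp_modulation p (c • φ)).coeFn_toLp, (memLp_modulation p φ).coeFn_toLp,
      Lp.coeFn_smul c φ, Lp.coeFn_smul c (memLp_modulation p φ).toLp] with x h1 h2 h3 h4
    simp only [RingHom.id_apply]
    rw [h1, h4, Pi.smul_apply, h2, h3, Pi.smul_apply, smul_eq_mul, smul_eq_mul]
    ring
  norm_map' φ := by
    change ‖(memLp_modulation p φ).toLp‖ = ‖φ‖
    rw [Lp.norm_toLp, Lp.norm_def]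
    congr 1
    refine eLpNorm_congr_norm_ae (Filter.Eventually.of_forall fun x => ?_)
    rw [norm_mul, mul_comm I, Complex.norm_exp_ofReal_mul_I, one_mul]

/-- The operator `exp (-i q p̂)` of translation, `φ ↦ φ(· - q)`, in `L²(ℝ)`. -/
def expMomentum (q : ℝ) : ConfL2 →ₗᵢ[ℂ] ConfL2 :=
  Lp.compMeasurePreservingₗᵢ ℂ (fun x : ℝ => x - q) (measurePreserving_sub_right volume q)

/-- The Weyl system `U(q,p) = exp (i (p q̂ - q p̂)) = e^{-iqp/2} exp (i p q̂) exp (-i q p̂)`. -/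
def weylSystem (z : ℝ × ℝ) : ConfL2 →L[ℂ] ConfL2 :=
  cexp (-(I / 2) * (z.1 * z.2 : ℝ)) •
    ((expPosition z.2).toContinuousLinearMap ∘L (expMomentum z.1).toContinuousLinearMap)

theorem weylSystem_apply (z : ℝ × ℝ) (φ : ConfL2) :
    weylSystem z φ =ᵐ[volume]
      fun x : ℝ => cexp (-(I / 2) * (z.1 * z.2 : ℝ)) * (cexp (I * (z.2 * x : ℝ)) * φ (x - z.1)) := by
  have h1 := Lp.coeFn_smul (cexp (-(I / 2) * (z.1 * z.2 : ℝ)))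
    (expPosition z.2 (expMomentum z.1 φ))
  have h2 := (memLp_modulation z.2 (expMomentum z.1 φ)).coeFn_toLp
  have h3 := Lp.coeFn_compMeasurePreserving φ (measurePreserving_sub_right volume z.1)
  filter_upwards [h1, h2, h3] with x h1 h2 h3
  refine h1.trans ?_
  rw [Pi.smul_apply, smul_eq_mul]
  refine congrArg _ (h2.trans ?_)
  exact congrArg _ h3

/-- The coefficient function `(q,p) ↦ ⟪U(q,p) ψ, φ⟫` of the Weyl system. -/
def weylCoeff (ψ φ : ConfL2) (z : ℝ × ℝ) : ℂ := ⟪weylSystem z ψ, φ⟫_ℂ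

/-- The standard symplectic form `σ((q,p),(q',p')) = q p' - p q'` on phase space. -/
def sympl (z w : ℝ × ℝ) : ℝ := z.1 * w.2 - z.2 * w.1

/-- `𝔖` is the (generalized) Wigner transform of the Weyl system: the bounded linear map
`𝓑₂(L²(ℝ)) → L²(ℝ × ℝ)` that extends
`|φ⟩⟨ψ| ↦ ((q,p) ↦ tr (U(q,p)* |φ⟩⟨ψ|) = ⟪U(q,p) ψ, φ⟫)`. -/
def IsWignerTransform (𝔖 : HilbertSchmidt ConfL2 →L[ℂ] PhaseL2) : Prop :=
  ∀ φ ψ : ConfL2, 𝔖 (HilbertSchmidt.rankOne φ ψ) =ᵐ[phaseMeasure] weylCoeff ψ φ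

/-- `𝓕` is the symplectic Fourier transform: the bounded linear map in `L²(ℝ × ℝ)` given by
`(𝓕 f)(q,p) = (2π)⁻¹ ∫ f(q',p') e^{i(qp' - pq')} dq' dp'` on `L¹ ∩ L²`. -/
def IsSymplecticFourier (𝓕 : PhaseL2 →L[ℂ] PhaseL2) : Prop :=
  ∀ f : PhaseL2, Integrable f volume →
    𝓕 f =ᵐ[phaseMeasure] fun z => 1 / (2 * Real.pi) * ∫ w, f w * cexp (I * sympl z w)

/-- The product of functions on phase space induced by a dequantization map `𝔖` and the
quantization map `𝔖*`: `(f₁, f₂) ↦ 𝔖 ((𝔖* f₁) (𝔖* f₂))`. -/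
def inducedProduct (𝔖 : HilbertSchmidt ConfL2 →L[ℂ] PhaseL2) (f₁ f₂ : PhaseL2) : PhaseL2 :=
  𝔖 (HilbertSchmidt.comp (ContinuousLinearMap.adjoint 𝔖 f₁) (ContinuousLinearMap.adjoint 𝔖 f₂))

/-- The Grönewold-Moyal kernel
`θ(q,p; q',p'; q'',p'') = exp (2i (qp' - pq' + q'p'' - p'q'' + q''p - p''q))`. -/
def moyalKernel (z z' z'' : ℝ × ℝ) : ℂ :=
  cexp (I * 2 * ((z.1 * z'.2 - z.2 * z'.1 + z'.1 * z''.2 - z'.2 * z''.1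
    + z''.1 * z.2 - z''.2 * z.1 : ℝ) : ℂ))

end Weyl

/-! ### Isometries determined by a Gram matrix -/

section HilbertSpace

variable {E F : Type*} [NormedAddCommGroup E] [InnerProductSpace ℂ E] [CompleteSpace E]
  [NormedAddCommGroup F] [InnerProductSpace ℂ F] [CompleteSpace F]

/-! Everything rests on the orthogonality relations. At fixed `q`, the coefficient `⟪U(q,p)ψ, φ⟫`
is, up to a unimodular factor, the Fourier transform of `x ↦ φ(x) conj(ψ(x - q))` at `p / 2π`.
Plancherel in `p`, Fubini, and the translation `y = x - q` then separate the integral into `⟪φ₁,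
φ₂⟫⟪ψ₂, ψ₁⟫`. This is also the Gram matrix of the rank one operators, so
`exists_linearIsometry_of_inner_eq` yields the Wigner transform `𝔖` as an isometry.

For surjectivity, replacing a Gaussian `g` by `U(-w)g` multiplies its diagonal coefficient by a
character. If `f` is orthogonal to all coefficients, the symplectic Fourier transform of `conj(f)
c_{g,g}` therefore vanishes identically. This function is integrable and `c_{g,g}` has no zeros,
hence `f = 0` (`eq_zero_of_inner_weylCoeffLp`).

The symplectic Fourier transform `𝓕` is isometric on `L¹ ∩ L²` by Plancherel and symmetric because
its kernel is hermitian. Hence `𝓕² = 𝓕*𝓕 = 1`.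

For rank one operators, the multiplication law of `U` turns the twisted convolution of coefficients
into an orthogonality integral (`twistedConv_weylCoeff`). The general case follows by density: at
each fixed point the twisted convolution is a bounded bilinear form on `L²`, and an `L²` limit is an
almost everywhere limit along a subsequence (`ae_eq_of_dense_span`).

For `f, g ∈ L¹`, Fubini gives `𝓕(f ⋆ g)(z) = (2π)⁻¹ ∫ g(v) e^{iσ(z,v)} (𝓕f)(z + v/2) dv`
(`symplFourier_twistedConv`). By density, `𝓕(𝓕f ⋆ g)` has the same form with `f` in place of `𝓕f`,
for all `f, g ∈ L²`. Taking `𝓕g` for `g`, writing it as an integral and substituting `v = 2(a - z)`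
produces the Grönewold–Moyal kernel. -/

/-- A family `s` with the same Gram matrix as a family `r` which contains a Hilbert basis is the
image of `r` under a linear isometry. -/
theorem exists_linearIsometry_of_inner_eq {ι κ : Type*} (b : HilbertBasis ι ℂ E) (k : ι → κ)
    {r : κ → E} {s : κ → F} (hk : ∀ i, b i = r (k i)) (h : ∀ i j, ⟪s i, s j⟫_ℂ = ⟪r i, r j⟫_ℂ) :
    ∃ T : E →ₗᵢ[ℂ] F, ∀ i, T (r i) = s i := by
  classical
  have ho : Orthonormal ℂ fun i => s (k i) := by
    rw [orthonormal_iff_ite]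
    intro i j
    rw [h, ← hk, ← hk]
    exact orthonormal_iff_ite.1 b.orthonormal i j
  let T : E →ₗᵢ[ℂ] F := ho.orthogonalFamily.linearIsometry.comp b.repr.toLinearIsometry
  have hT : ∀ i, T (r (k i)) = s (k i) := fun i => by
    rw [← hk]
    change ho.orthogonalFamily.linearIsometry (b.repr (b i)) = _
    rw [b.repr_self, OrthogonalFamily.linearIsometry_apply_single]
    simp
  refine ⟨T, fun j => ?_⟩
  -- `T` is prescribed only on the basis. For any other `r j` the Gram matrix gives the coordinates
  -- of `T* (s j)`, namely `⟪s (k i), s j⟫ = ⟪r (k i), r j⟫`. Then `‖T (r j) - s j‖²` expands into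
  -- four terms of equal modulus that cancel.
  have hadj : ContinuousLinearMap.adjoint T.toContinuousLinearMap (s j) = r j := by
    apply b.repr.injective
    ext i
    rw [b.repr_apply_apply, b.repr_apply_apply, ContinuousLinearMap.adjoint_inner_right]
    change ⟪T (b i), _⟫_ℂ = _
    rw [hk, hT, h]
  have h1 : ⟪T (r j), s j⟫_ℂ = ⟪r j, r j⟫_ℂ := by
    conv_rhs => rw [← hadj, ContinuousLinearMap.adjoint_inner_right]
    rw [hadj]
    rfl
  have h2 : ⟪s j, T (r j)⟫_ℂ = ⟪r j, r j⟫_ℂ := by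
    rw [← inner_conj_symm, h1, inner_conj_symm]
  rw [← sub_eq_zero, ← inner_self_eq_zero (𝕜 := ℂ), inner_sub_left, inner_sub_right,
    inner_sub_right, T.inner_map_map, h1, h2, h]
  ring

end HilbertSpace

/-! ### Rank one operators and composition in the Hilbert–Schmidt space -/

namespace HilbertSchmidt

variable {H : Type*} [NormedAddCommGroup H] [InnerProductSpace ℂ H] [CompleteSpace H]

theorem toCLM_rankOne_apply (φ ψ x : H) : toCLM (rankOne φ ψ) x = ⟪ψ, x⟫_ℂ • φ :=
  InnerProductSpace.rankOne_apply ..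

theorem toCLM_comp (A B : HilbertSchmidt H) : toCLM (comp A B) = toCLM A ∘L toCLM B := rfl

/-- The defining sum is `∑ ⟪A*φ, eᵢ⟫⟪eᵢ, ψ⟫`, which Parseval evaluates. -/
theorem inner_rankOne_left (φ ψ : H) (A : HilbertSchmidt H) :
    ⟪rankOne φ ψ, A⟫_ℂ = ⟪φ, toCLM A ψ⟫_ℂ := by
  refine (hasSum_inner (hsBasis H) (rankOne φ ψ) A).unique ?_
  have h := (hsBasis H).hasSum_inner_mul_inner (ContinuousLinearMap.adjoint (toCLM A) φ) ψ
  rw [ContinuousLinearMap.adjoint_inner_left] at h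
  refine h.congr_fun fun i => ?_
  rw [toCLM_rankOne_apply, inner_smul_left, inner_conj_symm,
    ContinuousLinearMap.adjoint_inner_left, mul_comm]

theorem inner_rankOne_rankOne (φ₁ ψ₁ φ₂ ψ₂ : H) :
    ⟪rankOne φ₁ ψ₁, rankOne φ₂ ψ₂⟫_ℂ = ⟪φ₁, φ₂⟫_ℂ * ⟪ψ₂, ψ₁⟫_ℂ := by
  rw [inner_rankOne_left, toCLM_rankOne_apply, inner_smul_right, mul_comm]

/-- Completeness: an operator orthogonal to every `|eᵢ⟩⟨eⱼ|` has all matrix entries `⟪eᵢ, A eⱼ⟫`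
equal to zero. -/
theorem exists_hilbertBasis_rankOne {ι : Type*} (b : HilbertBasis ι ℂ H) :
    ∃ v : HilbertBasis (ι × ι) ℂ (HilbertSchmidt H), ∀ i, v i = rankOne (b i.1) (b i.2) := by
  classical
  have ho : Orthonormal ℂ fun i : ι × ι => rankOne (b i.1) (b i.2) := by
    rw [orthonormal_iff_ite]
    rintro ⟨i, j⟩ ⟨k, l⟩
    rw [inner_rankOne_rankOne, orthonormal_iff_ite.1 b.orthonormal,
      orthonormal_iff_ite.1 b.orthonormal]
    by_cases h1 : i = k <;> by_cases h2 : j = l <;> simp [h1, h2, Ne.symm]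
  have hsp : (Submodule.span ℂ (Set.range fun i : ι × ι => rankOne (b i.1) (b i.2)))ᗮ = ⊥ := by
    rw [Submodule.eq_bot_iff]
    intro A hA
    apply toCLM_injective
    rw [map_zero]
    refine ContinuousLinearMap.ext_on (s := Set.range b) ?_ ?_
    · rw [dense_iff_closure_eq, ← Submodule.topologicalClosure_coe, b.dense_span]
      rfl
    · rintro _ ⟨j, rfl⟩
      apply b.repr.injective
      ext i
      rw [b.repr_apply_apply, ← inner_rankOne_left]
      simpa using (Submodule.mem_orthogonal _ _).1 hA _ (Submodule.subset_span ⟨(i, j), rfl⟩)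
  exact ⟨HilbertBasis.mkOfOrthogonalEqBot ho hsp, fun i => by
    rw [HilbertBasis.coe_mkOfOrthogonalEqBot]⟩

theorem dense_span_rankOne :
    Dense (Submodule.span ℂ {A | ∃ φ ψ : H, A = rankOne φ ψ} : Set (HilbertSchmidt H)) := by
  obtain ⟨v, hv⟩ := exists_hilbertBasis_rankOne (hsBasis H)
  have h : Dense (Submodule.span ℂ (Set.range v) : Set (HilbertSchmidt H)) := by
    rw [dense_iff_closure_eq, ← Submodule.topologicalClosure_coe, v.dense_span]
    rfl
  refine h.mono (Submodule.span_mono ?_)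
  rintro _ ⟨i, rfl⟩
  exact ⟨_, _, hv i⟩

/-- A unit vector extends to a Hilbert basis, and `‖A y‖²` is then one term of the basis-independent
sum `‖A‖²`. -/
theorem norm_toCLM_apply_le (A : HilbertSchmidt H) (x : H) : ‖toCLM A x‖ ≤ ‖A‖ * ‖x‖ := by
  refine ContinuousLinearMap.le_of_opNorm_le _ ?_ x
  refine ContinuousLinearMap.opNorm_le_of_unit_norm (norm_nonneg _) fun y hy => ?_
  have ho : Orthonormal ℂ ((↑) : ({y} : Set H) → H) := by
    rw [orthonormal_subsingleton_iff]
    rintro ⟨_, rfl⟩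
    exact hy
  obtain ⟨w, b, hyw, hb⟩ := ho.exists_hilbertBasis_extension
  have h := le_hasSum (hasSum_norm_sq b A) ⟨y, hyw rfl⟩ fun i _ => by positivity
  rw [hb] at h
  exact (sq_le_sq₀ (norm_nonneg _) (norm_nonneg _)).1 h

theorem norm_comp_le (A B : HilbertSchmidt H) : ‖comp A B‖ ≤ ‖A‖ * ‖B‖ := by
  refine (sq_le_sq₀ (norm_nonneg _) (by positivity)).1 ?_
  rw [mul_pow]
  refine hasSum_le (fun i => ?_) (hasSum_norm_sq (hsBasis H) (comp A B))
    ((hasSum_norm_sq (hsBasis H) B).mul_left _)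
  rw [← mul_pow]
  gcongr
  exact norm_toCLM_apply_le A (toCLM B (hsBasis H i))

/-- Composition of Hilbert-Schmidt operators as a bounded bilinear map. -/
noncomputable def compL :
    HilbertSchmidt H →L[ℂ] HilbertSchmidt H →L[ℂ] HilbertSchmidt H :=
  LinearMap.mkContinuous₂
    (LinearMap.mk₂ ℂ comp
      (fun A B C => toCLM_injective (by simp [toCLM_comp, ContinuousLinearMap.add_comp]))
      (fun c A B => toCLM_injective (by simp [toCLM_comp]))
      (fun A B C => toCLM_injective (by simp [toCLM_comp]))
      (fun c A B => toCLM_injective (by simp [toCLM_comp]))) 1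
    fun A B => by simpa using norm_comp_le A B

theorem compL_apply (A B : HilbertSchmidt H) : compL A B = comp A B := rfl

theorem rankOne_comp_rankOne (φ₁ ψ₁ φ₂ ψ₂ : H) :
    comp (rankOne φ₁ ψ₁) (rankOne φ₂ ψ₂) = ⟪ψ₁, φ₂⟫_ℂ • rankOne φ₁ ψ₂ := by
  apply toCLM_injective
  ext x
  simp [toCLM_comp, toCLM_rankOne_apply, smul_smul, mul_comm]

end HilbertSchmidt

/-! ### The Fourier transform on `L¹ ∩ L²` -/

section Plancherel

open FourierTransform SchwartzMap

variable {V : Type*} [NormedAddCommGroup V] [InnerProductSpace ℝ V] [FiniteDimensional ℝ V]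
  [MeasurableSpace V] [BorelSpace V]

theorem integral_fourier_mul_of_integrable {f g : V → ℂ} (hf : Integrable f) (hg : Integrable g) :
    ∫ ξ, 𝓕 f ξ * g ξ = ∫ x, f x * 𝓕 g x := by
  simpa using! VectorFourier.integral_fourierIntegral_smul_eq_flip (L := innerₗ V)
    Real.continuous_fourierChar continuous_inner hf hg

theorem locallyIntegrable_fourier {f : V → ℂ} (hf : Integrable f) :
    LocallyIntegrable (𝓕 f : V → ℂ) := by
  have : Continuous (𝓕 f : V → ℂ) := VectorFourier.fourierIntegral_continuous
      Real.continuous_fourierChar continuous_inner hf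
  exact this.locallyIntegrable

/-- The Fourier transform in `L²` is given by the Fourier integral on `L¹ ∩ L²`. -/
theorem fourier_toLp_ae_eq {f : V → ℂ} (hf : Integrable f) (hf2 : MemLp f 2) :
    (𝓕 (hf2.toLp f) : Lp ℂ 2 (volume : Measure V)) =ᵐ[volume] (𝓕 f : V → ℂ) := by
  have h1 := (Lp.memLp (𝓕 (hf2.toLp f) : Lp ℂ 2 (volume : Measure V))).locallyIntegrable
    (by norm_num)
  have h2 := locallyIntegrable_fourier hf
  have key : (fun x => (𝓕 (hf2.toLp f) : Lp ℂ 2 (volume : Measure V)) x - (𝓕 f : V → ℂ) x)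
      =ᵐ[volume] 0 := by
    apply ae_eq_zero_of_integral_contDiff_smul_eq_zero (h1.sub h2)
    intro g hg hgc
    have hg₁ : HasCompactSupport (Complex.ofRealCLM ∘ g) := hgc.comp_left rfl
    have hg₂ : ContDiff ℝ (↑(⊤ : ℕ∞)) (Complex.ofRealCLM ∘ g) := by fun_prop
    let G : 𝓢(V, ℂ) := hg₁.toSchwartzMap hg₂
    have hG : ∀ x, G x = (g x : ℂ) := fun x => rfl
    -- The `L²` transform agrees with that of tempered distributions, so against a test function it
    -- moves onto `G`. The multiplication formula for integrable functions moves it back onto `f` as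
    -- a Fourier integral.
    have e := congrArg (fun T : 𝓢'(V, ℂ) => T G)
      (Lp.fourier_toTemperedDistribution_eq (hf2.toLp f))
    simp only [TemperedDistribution.fourier_apply, Lp.toTemperedDistribution_apply] at e
    have e2 : ∫ x, (𝓕 G) x • (hf2.toLp f) x = ∫ x, (𝓕 f : V → ℂ) x * G x := by
      rw [integral_fourier_mul_of_integrable hf G.integrable]
      refine integral_congr_ae ?_
      filter_upwards [hf2.coeFn_toLp] with x hx
      rw [hx, smul_eq_mul, mul_comm, SchwartzMap.fourier_coe]
    rw [e2] at e
    have i1 := h1.integrable_smul_left_of_hasCompactSupport hg.continuous hgc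
    have i2 := h2.integrable_smul_left_of_hasCompactSupport hg.continuous hgc
    simp only [Pi.sub_apply, smul_sub] at *
    rw [integral_sub i1 i2, sub_eq_zero]
    simp only [Complex.real_smul, smul_eq_mul, hG] at *
    rw [← e]
    exact integral_congr_ae (Filter.Eventually.of_forall fun x => mul_comm _ _)
  filter_upwards [key] with x hx
  exact sub_eq_zero.1 hx

theorem memLp_fourier {f : V → ℂ} (hf : Integrable f) (hf2 : MemLp f 2) :
    MemLp (𝓕 f : V → ℂ) 2 :=
  (memLp_congr_ae (fourier_toLp_ae_eq hf hf2)).1 (Lp.memLp _)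

theorem eLpNorm_fourier {f : V → ℂ} (hf : Integrable f) (hf2 : MemLp f 2) :
    eLpNorm (𝓕 f : V → ℂ) 2 = eLpNorm f 2 := by
  rw [← eLpNorm_congr_ae (fourier_toLp_ae_eq hf hf2), ← eLpNorm_congr_ae hf2.coeFn_toLp,
    ← Lp.enorm_def, ← Lp.enorm_def, ← ofReal_norm, Lp.norm_fourier_eq, ofReal_norm]

/-- **Plancherel's theorem** on `L¹ ∩ L²`. -/
theorem integral_conj_fourier_mul_fourier {f g : V → ℂ} (hf : Integrable f) (hf2 : MemLp f 2)
    (hg : Integrable g) (hg2 : MemLp g 2) :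
    ∫ ξ, (starRingEnd ℂ) (𝓕 f ξ) * 𝓕 g ξ = ∫ x, (starRingEnd ℂ) (f x) * g x := by
  have h := Lp.inner_fourier_eq (hf2.toLp f) (hg2.toLp g)
  rw [L2.inner_def, L2.inner_def] at h
  convert h using 1 <;> refine integral_congr_ae ?_
  · filter_upwards [fourier_toLp_ae_eq hf hf2, fourier_toLp_ae_eq hg hg2] with x h1 h2
    rw [h1, h2, RCLike.inner_apply, mul_comm]
  · filter_upwards [hf2.coeFn_toLp, hg2.coeFn_toLp] with x h1 h2
    rw [h1, h2, RCLike.inner_apply, mul_comm]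

/-- The Fourier transform is injective on `L¹`. -/
theorem ae_eq_zero_of_fourier_eq_zero {f : V → ℂ} (hf : Integrable f) (h : ∀ ξ, 𝓕 f ξ = 0) :
    f =ᵐ[volume] 0 := by
  apply ae_eq_zero_of_integral_contDiff_smul_eq_zero hf.locallyIntegrable
  intro g hg hgc
  have hg₁ : HasCompactSupport (Complex.ofRealCLM ∘ g) := hgc.comp_left rfl
  have hg₂ : ContDiff ℝ (↑(⊤ : ℕ∞)) (Complex.ofRealCLM ∘ g) := by fun_prop
  let G : 𝓢(V, ℂ) := hg₁.toSchwartzMap hg₂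
  have hG : ∀ x, G x = (g x : ℂ) := fun x => rfl
  -- Testing `𝓕 f = 0` against `𝓕⁻ G` amounts to testing `f` against `G`.
  have e := integral_fourier_mul_of_integrable hf (𝓕⁻ G).integrable
  rw [← SchwartzMap.fourier_coe] at e
  simp only [FourierTransform.fourier_fourierInv_eq, h, zero_mul, integral_zero, hG] at e
  rw [e]
  exact integral_congr_ae (Filter.Eventually.of_forall fun x => by simp [mul_comm])

end Plancherel

/-! ### Phase space and the symplectic Fourier transform -/

section PhaseSpace

theorem ae_phaseMeasure : ae phaseMeasure = ae (volume : Measure (ℝ × ℝ)) :=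
  Measure.ae_ennreal_smul_measure_eq (by simpa using Real.pi_pos) _

instance : phaseMeasure.Regular := Measure.Regular.smul ENNReal.ofReal_ne_top

theorem memLp_phaseMeasure {f : ℝ × ℝ → ℂ} {p : ℝ≥0∞} :
    MemLp f p phaseMeasure ↔ MemLp f p volume := by
  refine ⟨fun h => ?_, fun h => h.smul_measure ENNReal.ofReal_ne_top⟩
  have h0 : ENNReal.ofReal (2 * Real.pi)⁻¹ ≠ 0 := by simpa using Real.pi_pos
  have := h.smul_measure (c := (ENNReal.ofReal (2 * Real.pi)⁻¹)⁻¹) (ENNReal.inv_ne_top.2 h0)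
  rwa [phaseMeasure, smul_smul, ENNReal.inv_mul_cancel h0 ENNReal.ofReal_ne_top, one_smul] at this

theorem eLpNorm_phaseMeasure (f : ℝ × ℝ → ℂ) :
    eLpNorm f 2 phaseMeasure =
      ENNReal.ofReal (2 * Real.pi)⁻¹ ^ (1 / 2 : ℝ≥0∞).toReal * eLpNorm f 2 volume :=
  eLpNorm_smul_measure_of_ne_top (by simp) ..

theorem integral_phaseMeasure (f : ℝ × ℝ → ℂ) :
    ∫ z, f z ∂phaseMeasure = 1 / (2 * Real.pi) * ∫ z, f z := by
  rw [phaseMeasure, integral_smul_measure, ENNReal.toReal_ofReal (by positivity), real_smul]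
  push_cast
  rw [one_div]

theorem PhaseL2.memLp (f : PhaseL2) : MemLp f 2 (volume : Measure (ℝ × ℝ)) :=
  memLp_phaseMeasure.1 (Lp.memLp f)

theorem integrable_unimodular_mul {α β : Type*} [TopologicalSpace α] [MeasurableSpace α]
    [OpensMeasurableSpace α] [TopologicalSpace β] [MeasurableSpace β] [OpensMeasurableSpace β]
    [SecondCountableTopologyEither α β] {μ : Measure α} {ν : Measure β} [SFinite ν]
    {k : α × β → ℂ} (hk : Continuous k) (hk1 : ∀ y, ‖k y‖ = 1)
    {f : α → ℂ} {g : β → ℂ} (hf : Integrable f μ) (hg : Integrable g ν) :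
    Integrable (fun y : α × β => k y * (f y.1 * g y.2)) (μ.prod ν) :=
  (hf.mul_prod hg).bdd_mul (c := 1) hk.aestronglyMeasurable
    (Filter.Eventually.of_forall fun y => (hk1 y).le)

theorem norm_cexp_I_mul_ofReal (x : ℝ) : ‖cexp (I * x)‖ = 1 := by
  rw [mul_comm, norm_exp_ofReal_mul_I]

theorem conj_cexp_I_mul_ofReal (x : ℝ) : (starRingEnd ℂ) (cexp (I * x)) = cexp (I * (-x : ℝ)) := by
  rw [← exp_conj]
  simp

theorem sympl_neg_swap (z w : ℝ × ℝ) : -sympl z w = sympl w z := by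
  simp only [sympl]; ring

@[fun_prop]
theorem continuous_sympl {X : Type*} [TopologicalSpace X] {f g : X → ℝ × ℝ} (hf : Continuous f)
    (hg : Continuous g) : Continuous fun x => sympl (f x) (g x) := by
  unfold sympl; fun_prop

/-! ### The symplectic Fourier transform -/

/-- The symplectic Fourier integral. -/
noncomputable def symplFourier (f : ℝ × ℝ → ℂ) (z : ℝ × ℝ) : ℂ :=
  1 / (2 * Real.pi) * ∫ w, f w * cexp (I * sympl z w)

/-- The linear change of variables relating the symplectic to the ordinary Fourier integral. -/
noncomputable def symplFreq (z : ℝ × ℝ) : ℂ :=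
  (2 * Real.pi)⁻¹ • (-I * Complex.measurableEquivRealProd.symm z)

open FourierTransform

/-- `ℝ × ℝ` carries the sup norm, so the Euclidean theory enters through `ℂ`. There multiplication
by `-I` turns the inner product into `-σ`, and the factor `(2π)⁻¹` absorbs the `2π` in the exponent
of the ordinary transform. -/
theorem symplFourier_eq (f : ℝ × ℝ → ℂ) (z : ℝ × ℝ) :
    symplFourier f z =
      1 / (2 * Real.pi) * 𝓕 (fun v => f (Complex.measurableEquivRealProd v)) (symplFreq z) := by
  rw [symplFourier, Real.fourier_eq', ← Complex.volume_preserving_equiv_real_prod.integral_comp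
    Complex.measurableEquivRealProd.measurableEmbedding]
  congr 2
  ext v
  rw [smul_eq_mul, mul_comm]
  congr 2
  rw [mul_comm]
  congr 2
  simp only [symplFreq, sympl, Complex.measurableEquivRealProd_apply, Complex.inner]
  have : Complex.measurableEquivRealProd.symm z = ⟨z.1, z.2⟩ := rfl
  rw [this]
  simp
  field_simp
  ring

theorem map_symplFreq :
    Measure.map symplFreq volume = ENNReal.ofReal ((2 * Real.pi) ^ 2) • volume := by
  have h1 : MeasurePreserving (fun z => -I * Complex.measurableEquivRealProd.symm z) := by
    have h2 : MeasurePreserving (fun z : ℂ => -I * z) := by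
      have h3 : ⇑(rotation (-Circle.exp (Real.pi / 2))) = fun z : ℂ => -I * z := by
        ext z
        rw [rotation_apply]
        simp [exp_pi_div_two_mul_I]
      rw [← h3]
      exact (rotation (-Circle.exp (Real.pi / 2))).measurePreserving
    exact h2.comp (Complex.volume_preserving_equiv_real_prod.symm _)
  have h3 : symplFreq = (fun x : ℂ => (2 * Real.pi)⁻¹ • x) ∘
      fun z => -I * Complex.measurableEquivRealProd.symm z := rfl
  rw [h3, ← Measure.map_map (measurable_const_smul _) h1.measurable, h1.map_eq,
    Measure.map_addHaar_smul _ (by positivity), Complex.finrank_real_complex, inv_pow, inv_inv,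
    abs_of_nonneg (by positivity)]

theorem continuous_symplFreq : Continuous symplFreq := by
  have : Continuous (Complex.measurableEquivRealProd.symm : ℝ × ℝ → ℂ) :=
    Complex.equivRealProdCLM.symm.continuous
  unfold symplFreq
  fun_prop

theorem continuous_symplFourier {f : ℝ × ℝ → ℂ} (hf : Integrable f) :
    Continuous (symplFourier f) := by
  unfold symplFourier
  refine continuous_const.mul ?_
  refine continuous_of_dominated (bound := fun w => ‖f w‖) ?_ ?_ hf.norm ?_
  · exact fun z => hf.aestronglyMeasurable.mul
      (by fun_prop : Continuous fun w => cexp (I * sympl z w)).aestronglyMeasurable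
  · exact fun z => Filter.Eventually.of_forall fun w => by
      rw [norm_mul, norm_cexp_I_mul_ofReal, mul_one]
  · exact Filter.Eventually.of_forall fun w => by fun_prop

/-- The change of frequency scales the measure by `(2π)²`, hence the `L²` norm by `2π`, which
cancels the prefactor `1 / 2π`. -/
theorem eLpNorm_symplFourier {f : ℝ × ℝ → ℂ} (hf : Integrable f) (hf2 : MemLp f 2) :
    eLpNorm (symplFourier f) 2 = eLpNorm f 2 := by
  have hp := Complex.volume_preserving_equiv_real_prod
  have hg := hp.integrable_comp_of_integrable hf
  have hg2 := hf2.comp_measurePreserving hp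
  have e : symplFourier f = (1 / (2 * Real.pi) : ℂ) •
      ((𝓕 (f ∘ Complex.measurableEquivRealProd) : ℂ → ℂ) ∘ symplFreq) := by
    ext z
    exact symplFourier_eq f z
  have hm : AEStronglyMeasurable (𝓕 (f ∘ Complex.measurableEquivRealProd) : ℂ → ℂ)
      (Measure.map symplFreq volume) := by
    rw [map_symplFreq]
    exact (memLp_fourier hg hg2).aestronglyMeasurable.smul_measure _
  rw [e, eLpNorm_const_smul, ← eLpNorm_map_measure hm continuous_symplFreq.aemeasurable,
    map_symplFreq, eLpNorm_smul_measure_of_ne_top (by simp), eLpNorm_fourier hg hg2,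
    eLpNorm_comp_measurePreserving hf2.aestronglyMeasurable hp, smul_eq_mul, ← mul_assoc]
  convert one_mul _
  rw [ENNReal.ofReal_pow (by positivity), ← ENNReal.rpow_natCast, ← ENNReal.rpow_mul]
  simp only [ENNReal.toReal_div, ENNReal.toReal_one, ENNReal.toReal_ofNat]
  rw [show ((2 : ℕ) : ℝ) * (1 / 2) = 1 by norm_num, ENNReal.rpow_one, ← ofReal_norm,
    ← ENNReal.ofReal_mul (norm_nonneg _), ENNReal.ofReal_eq_one, norm_div, norm_mul, norm_real,
    Real.norm_of_nonneg Real.pi_pos.le]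
  have := Real.pi_ne_zero
  simp
  field_simp

theorem memLp_symplFourier {f : ℝ × ℝ → ℂ} (hf : Integrable f) (hf2 : MemLp f 2) :
    MemLp (symplFourier f) 2 phaseMeasure :=
  memLp_phaseMeasure.2 ⟨(continuous_symplFourier hf).aestronglyMeasurable, by
    rw [eLpNorm_symplFourier hf hf2]; exact hf2.2⟩

theorem ae_eq_zero_of_symplFourier_eq_zero {f : ℝ × ℝ → ℂ} (hf : Integrable f)
    (h : ∀ z, symplFourier f z = 0) : f =ᵐ[volume] 0 := by
  have hp := Complex.volume_preserving_equiv_real_prod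
  have h0 := ae_eq_zero_of_fourier_eq_zero (hp.integrable_comp_of_integrable hf) fun ξ => by
    -- As `-I * I = 1`, the point `2π I ξ` is the preimage of `ξ` under `symplFreq`.
    have h1 : symplFreq (Complex.measurableEquivRealProd ((2 * Real.pi) • (I * ξ))) = ξ := by
      rw [symplFreq, MeasurableEquiv.symm_apply_apply, mul_smul_comm, smul_smul,
        inv_mul_cancel₀ (by positivity), one_smul, ← mul_assoc]
      simp
    have h2 := h (Complex.measurableEquivRealProd ((2 * Real.pi) • (I * ξ)))
    rw [symplFourier_eq, h1] at h2
    have h3 : (1 / (2 * Real.pi) : ℂ) ≠ 0 := by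
      have := Real.pi_ne_zero
      simp [this]
    exact (mul_eq_zero.1 h2).resolve_left h3
  have h1 := (hp.symm _).quasiMeasurePreserving.ae_eq_comp h0
  filter_upwards [h1] with z hz
  simpa using hz

/-- `L¹ ∩ L²` as a subspace of `L²(ℝ × ℝ)`. -/
def integrableSubmodule : Submodule ℂ PhaseL2 where
  carrier := {f | Integrable f (volume : Measure (ℝ × ℝ))}
  zero_mem' := by
    have h : ⇑(0 : PhaseL2) =ᵐ[volume] 0 := by
      rw [← ae_phaseMeasure]; exact Lp.coeFn_zero _ _ _
    exact (integrable_zero _ _ _).congr h.symm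
  add_mem' {f g} hf hg := by
    have h : ⇑(f + g) =ᵐ[volume] f + g := by
      rw [← ae_phaseMeasure]; exact Lp.coeFn_add _ _
    exact (hf.add hg).congr h.symm
  smul_mem' c f hf := by
    have h : ⇑(c • f) =ᵐ[volume] c • f := by
      rw [← ae_phaseMeasure]; exact Lp.coeFn_smul _ _
    exact (hf.smul c).congr h.symm

theorem dense_integrableSubmodule : Dense (integrableSubmodule : Set PhaseL2) := by
  rw [Metric.dense_iff]
  intro f r hr
  obtain ⟨g, hgc, hg, hgcont, hgL⟩ := (Lp.memLp f).exists_hasCompactSupport_eLpNorm_sub_le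
    (by simp) (ε := ENNReal.ofReal (r / 2)) (by simpa using hr)
  refine ⟨hgL.toLp g, ?_, ?_⟩
  · rw [Metric.mem_ball, dist_comm, Lp.dist_def]
    refine (ENNReal.toReal_le_of_le_ofReal (by positivity) (le_trans (le_of_eq ?_) hg)).trans_lt
      (half_lt_self hr)
    exact eLpNorm_congr_ae ((ae_eq_refl _).sub hgL.coeFn_toLp)
  · have h := hgL.coeFn_toLp
    rw [ae_phaseMeasure] at h
    exact (hgcont.integrable_of_hasCompactSupport hgc).congr h.symm

theorem symplFourier_congr {f g : ℝ × ℝ → ℂ} (h : f =ᵐ[volume] g) :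
    symplFourier f = symplFourier g := by
  ext z
  rw [symplFourier, symplFourier]
  congr 1
  exact integral_congr_ae (h.mono fun w hw => by simp only [hw])

theorem integrable_mul_cexp_sympl {f : ℝ × ℝ → ℂ} (hf : Integrable f) (z : ℝ × ℝ) :
    Integrable fun w => f w * cexp (I * sympl z w) :=
  hf.mul_bdd (c := 1) (by fun_prop : Continuous fun w => cexp (I * sympl z w)).aestronglyMeasurable
    (Filter.Eventually.of_forall fun w => (norm_cexp_I_mul_ofReal _).le)

theorem symplFourier_add {f g : ℝ × ℝ → ℂ} (hf : Integrable f) (hg : Integrable g) :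
    symplFourier (f + g) = symplFourier f + symplFourier g := by
  ext z
  simp only [symplFourier, Pi.add_apply, add_mul]
  rw [integral_add (integrable_mul_cexp_sympl hf z) (integrable_mul_cexp_sympl hg z), mul_add]

theorem symplFourier_smul (c : ℂ) (f : ℝ × ℝ → ℂ) :
    symplFourier (c • f) = c • symplFourier f := by
  ext z
  simp only [symplFourier, Pi.smul_apply, smul_eq_mul, mul_assoc, integral_const_mul]
  ring

/-- The symplectic Fourier transform on `L¹ ∩ L²`. -/
noncomputable def symplFourierₗ : integrableSubmodule →ₗ[ℂ] PhaseL2 where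
  toFun f := (memLp_symplFourier f.2 f.1.memLp).toLp
  map_add' f g := by
    rw [← MemLp.toLp_add]
    congr 1
    rw [← symplFourier_add f.2 g.2]
    refine symplFourier_congr ?_
    rw [← ae_phaseMeasure]
    exact Lp.coeFn_add _ _
  map_smul' c f := by
    rw [RingHom.id_apply, ← MemLp.toLp_const_smul]
    congr 1
    rw [← symplFourier_smul c]
    refine symplFourier_congr ?_
    rw [← ae_phaseMeasure]
    exact Lp.coeFn_smul _ _

theorem norm_symplFourierₗ (f : integrableSubmodule) : ‖symplFourierₗ f‖ = ‖(f : PhaseL2)‖ := by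
  change ‖(memLp_symplFourier f.2 f.1.memLp).toLp‖ = _
  rw [Lp.norm_toLp, Lp.norm_def, eLpNorm_phaseMeasure, eLpNorm_phaseMeasure,
    eLpNorm_symplFourier f.2 f.1.memLp]

/-- The symplectic Fourier transform in `L²(ℝ × ℝ)`. -/
noncomputable def symplFourierL : PhaseL2 →L[ℂ] PhaseL2 :=
  symplFourierₗ.extendOfNorm integrableSubmodule.subtype

theorem symplFourierL_apply (f : integrableSubmodule) : symplFourierL f = symplFourierₗ f :=
  LinearMap.extendOfNorm_eq (e := integrableSubmodule.subtype)
    (by simpa [DenseRange] using dense_integrableSubmodule)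
    ⟨1, fun f => by rw [norm_symplFourierₗ, one_mul]; rfl⟩ f

theorem isSymplecticFourier_symplFourierL : IsSymplecticFourier symplFourierL := by
  intro f hf
  rw [symplFourierL_apply ⟨f, hf⟩]
  exact (memLp_symplFourier hf f.memLp).coeFn_toLp

theorem IsSymplecticFourier.eq {T : PhaseL2 →L[ℂ] PhaseL2} (hT : IsSymplecticFourier T) :
    T = symplFourierL := by
  refine ContinuousLinearMap.ext_on (s := (integrableSubmodule : Set PhaseL2)) ?_ ?_
  · rw [Submodule.span_eq]
    exact dense_integrableSubmodule
  · intro f hf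
    exact Lp.ext ((hT f hf).trans (isSymplecticFourier_symplFourierL f hf).symm)

theorem norm_symplFourierL (f : PhaseL2) : ‖symplFourierL f‖ = ‖f‖ := by
  refine dense_integrableSubmodule.induction (P := fun f => ‖symplFourierL f‖ = ‖f‖)
    (fun f hf => ?_) (isClosed_eq (by fun_prop) (by fun_prop)) f
  rw [symplFourierL_apply ⟨f, hf⟩, norm_symplFourierₗ]

/-- The kernel is hermitian: by antisymmetry of `σ`, conjugating `e^{iσ(z,w)}` exchanges its
arguments. Integrability of `f` and `g` justifies Fubini. -/
theorem inner_symplFourierL_of_integrable {f g : PhaseL2}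
    (hf : Integrable f (volume : Measure (ℝ × ℝ))) (hg : Integrable g (volume : Measure (ℝ × ℝ))) :
    ⟪symplFourierL f, g⟫_ℂ = ⟪f, symplFourierL g⟫_ℂ := by
  rw [L2.inner_def, L2.inner_def]
  have e1 : ∫ z, ⟪symplFourierL f z, g z⟫_ℂ ∂phaseMeasure = ∫ z, 1 / (2 * Real.pi) *
      (∫ w, cexp (I * sympl w z) * ((starRingEnd ℂ) (f w) * g z)) ∂phaseMeasure := by
    refine integral_congr_ae ?_
    filter_upwards [isSymplecticFourier_symplFourierL f hf] with z hz
    rw [hz, RCLike.inner_apply, map_mul, ← integral_conj, mul_comm (g z), mul_assoc,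
      ← integral_mul_const]
    congr 1
    · simp [map_ofNat]
    · refine integral_congr_ae (Filter.Eventually.of_forall fun w => ?_)
      simp only [map_mul, conj_cexp_I_mul_ofReal, sympl_neg_swap]
      ring
  have e2 : ∫ w, ⟪f w, symplFourierL g w⟫_ℂ ∂phaseMeasure = ∫ w, 1 / (2 * Real.pi) *
      (∫ z, cexp (I * sympl w z) * ((starRingEnd ℂ) (f w) * g z)) ∂phaseMeasure := by
    refine integral_congr_ae ?_
    filter_upwards [isSymplecticFourier_symplFourierL g hg] with z hz
    rw [hz, RCLike.inner_apply, mul_assoc, ← integral_mul_const]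
    congr 1
    refine integral_congr_ae (Filter.Eventually.of_forall fun w => ?_)
    ring
  rw [e1, e2, integral_phaseMeasure, integral_phaseMeasure, integral_const_mul,
    integral_const_mul]
  congr 2
  refine (integral_integral_swap ?_).symm
  exact integrable_unimodular_mul (k := fun y : (ℝ × ℝ) × (ℝ × ℝ) => cexp (I * sympl y.1 y.2))
    (f := fun w => (starRingEnd ℂ) (f w)) (by fun_prop)
    (fun y => norm_cexp_I_mul_ofReal _) 
    (Complex.conjCLE.toContinuousLinearMap.integrable_comp hf) hg

theorem isSelfAdjoint_symplFourierL : IsSelfAdjoint symplFourierL := by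
  rw [ContinuousLinearMap.isSelfAdjoint_iff_isSymmetric]
  intro f g
  refine dense_integrableSubmodule.induction
    (P := fun f => ⟪symplFourierL f, g⟫_ℂ = ⟪f, symplFourierL g⟫_ℂ)
    (fun f hf => ?_) (isClosed_eq (by fun_prop) (by fun_prop)) f
  refine dense_integrableSubmodule.induction
    (P := fun g => ⟪symplFourierL f, g⟫_ℂ = ⟪f, symplFourierL g⟫_ℂ)
    (fun g hg => ?_) (isClosed_eq (by fun_prop) (by fun_prop)) g
  exact inner_symplFourierL_of_integrable hf hg

theorem symplFourierL_mul_self : symplFourierL * symplFourierL = 1 := by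
  have h := (ContinuousLinearMap.norm_map_iff_adjoint_comp_self symplFourierL).1 norm_symplFourierL
  rwa [← ContinuousLinearMap.star_eq_adjoint, isSelfAdjoint_symplFourierL.star_eq] at h

theorem symplFourierL_symplFourierL (f : PhaseL2) : symplFourierL (symplFourierL f) = f :=
  DFunLike.congr_fun symplFourierL_mul_self f

theorem symplFourierL_mem_unitary : symplFourierL ∈ unitary (PhaseL2 →L[ℂ] PhaseL2) := by
  rw [Unitary.mem_iff, isSelfAdjoint_symplFourierL.star_eq]
  exact ⟨symplFourierL_mul_self, symplFourierL_mul_self⟩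

end PhaseSpace

/-! ### The Weyl system: unitarity, orthogonality relations, Wigner transform -/

section WeylSystem

open FourierTransform

theorem norm_weylSystem_apply (z : ℝ × ℝ) (φ : ConfL2) : ‖weylSystem z φ‖ = ‖φ‖ := by
  change ‖cexp (-(I / 2) * (z.1 * z.2 : ℝ)) • expPosition z.2 (expMomentum z.1 φ)‖ = _
  rw [norm_smul, LinearIsometry.norm_map, LinearIsometry.norm_map,
    show -(I / 2) * ((z.1 * z.2 : ℝ) : ℂ) = I * ((-(z.1 * z.2) / 2 : ℝ) : ℂ) by push_cast; ring,
    norm_cexp_I_mul_ofReal, one_mul]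

theorem weylSystem_add (z w : ℝ × ℝ) :
    weylSystem (z + w) = cexp (I / 2 * sympl z w) • (weylSystem z ∘L weylSystem w) := by
  ext1 φ
  refine Lp.ext ?_
  have h1 := weylSystem_apply (z + w) φ
  have h2 := Lp.coeFn_smul (cexp (I / 2 * sympl z w)) (weylSystem z (weylSystem w φ))
  have h3 := weylSystem_apply z (weylSystem w φ)
  have h4 := (eventually_sub_right_iff volume z.1).2 (weylSystem_apply w φ)
  filter_upwards [h1, h2, h3, h4] with x h1 h2 h3 h4
  rw [h1]
  refine Eq.trans ?_ h2.symm
  rw [Pi.smul_apply, h3, h4, smul_eq_mul]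
  simp only [← mul_assoc, ← Complex.exp_add]
  rw [show x - (z + w).1 = x - z.1 - w.1 by simp; ring]
  congr 2
  simp only [sympl, Prod.fst_add, Prod.snd_add]
  push_cast
  ring

theorem weylSystem_zero : weylSystem 0 = 1 := by
  ext1 φ
  refine Lp.ext ?_
  filter_upwards [weylSystem_apply 0 φ] with x hx
  rw [hx]
  simp

theorem weylSystem_comp (z w : ℝ × ℝ) :
    weylSystem z ∘L weylSystem w = cexp (I * (-(sympl z w / 2) : ℝ)) • weylSystem (z + w) := by
  rw [weylSystem_add, smul_smul, ← Complex.exp_add]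
  push_cast
  ring_nf
  simp

theorem weylSystem_comp_neg (z : ℝ × ℝ) : weylSystem z ∘L weylSystem (-z) = 1 := by
  rw [weylSystem_comp, add_neg_cancel, weylSystem_zero]
  simp [sympl, mul_comm]

theorem adjoint_weylSystem_comp_self (z : ℝ × ℝ) :
    ContinuousLinearMap.adjoint (weylSystem z) ∘L weylSystem z = 1 :=
  (ContinuousLinearMap.norm_map_iff_adjoint_comp_self _).1 (norm_weylSystem_apply z)

/-- The adjoint is a left inverse of `U(z)` and `U(-z)` is a right inverse, so they coincide. -/
theorem adjoint_weylSystem (z : ℝ × ℝ) :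
    ContinuousLinearMap.adjoint (weylSystem z) = weylSystem (-z) := by
  calc ContinuousLinearMap.adjoint (weylSystem z)
      = ContinuousLinearMap.adjoint (weylSystem z) ∘L (weylSystem z ∘L weylSystem (-z)) := by
        rw [weylSystem_comp_neg]; rfl
    _ = weylSystem (-z) := by
        rw [← ContinuousLinearMap.comp_assoc, adjoint_weylSystem_comp_self]; rfl

theorem weylSystem_mem_unitary (z : ℝ × ℝ) : weylSystem z ∈ unitary (ConfL2 →L[ℂ] ConfL2) := by
  rw [Unitary.mem_iff, ContinuousLinearMap.star_eq_adjoint]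
  refine ⟨adjoint_weylSystem_comp_self z, ?_⟩
  rw [adjoint_weylSystem]
  exact weylSystem_comp_neg z

theorem inner_weylSystem_weylSystem (z : ℝ × ℝ) (φ ψ : ConfL2) :
    ⟪weylSystem z φ, weylSystem z ψ⟫_ℂ = ⟪φ, ψ⟫_ℂ := by
  rw [← ContinuousLinearMap.adjoint_inner_right]
  exact congrArg _ (DFunLike.congr_fun (adjoint_weylSystem_comp_self z) ψ)

/-- The coefficients of translated vectors are modulated coefficients. -/
theorem weylCoeff_weylSystem (w z : ℝ × ℝ) (φ ψ : ConfL2) :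
    weylCoeff (weylSystem w ψ) (weylSystem w φ) z = cexp (I * sympl z w) * weylCoeff ψ φ z := by
  have h1 := DFunLike.congr_fun (weylSystem_comp z w) ψ
  have h2 := DFunLike.congr_fun (weylSystem_add w z) ψ
  have h3 : weylSystem z (weylSystem w ψ) =
      cexp (I * (sympl w z : ℝ)) • weylSystem w (weylSystem z ψ) := by
    refine h1.trans ?_
    rw [add_comm z w, smul_apply, h2, smul_apply, smul_smul, ← Complex.exp_add]
    refine congrArg (fun c : ℂ => cexp c • weylSystem w (weylSystem z ψ)) ?_
    rw [← sympl_neg_swap w z]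
    push_cast
    ring
  rw [weylCoeff, h3, inner_smul_left, conj_cexp_I_mul_ofReal, sympl_neg_swap,
    inner_weylSystem_weylSystem]
  rfl

/-! ### The orthogonality relations -/

/-- The function `(q, x) ↦ φ(x) conj(ψ(x - q))`. -/
noncomputable def translateMul (ψ φ : ConfL2) (y : ℝ × ℝ) : ℂ :=
  φ y.2 * (starRingEnd ℂ) (ψ (y.2 - y.1))

theorem measurable_translateMul (ψ φ : ConfL2) : Measurable (translateMul ψ φ) := by
  have h1 := (Lp.stronglyMeasurable φ).measurable
  have h2 := (Lp.stronglyMeasurable ψ).measurable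
  have h3 : Measurable (starRingEnd ℂ : ℂ → ℂ) := continuous_conj.measurable
  unfold translateMul
  fun_prop

theorem integrable_translateMul (ψ φ : ConfL2) (q : ℝ) :
    Integrable fun x => translateMul ψ φ (q, x) := by
  have h : MemLp (fun x => (starRingEnd ℂ) (ψ (x - q))) 2 volume :=
    ((Lp.memLp ψ).comp_measurePreserving (measurePreserving_sub_right volume q)).star
  exact (Lp.memLp φ).integrable_mul h

theorem weylCoeff_eq_integral (ψ φ : ConfL2) (z : ℝ × ℝ) :
    weylCoeff ψ φ z = cexp (I * (z.1 * z.2 / 2 : ℝ)) *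
      ∫ x, cexp (I * (-(z.2 * x) : ℝ)) * translateMul ψ φ (z.1, x) := by
  rw [weylCoeff, L2.inner_def, ← integral_const_mul]
  refine integral_congr_ae ?_
  filter_upwards [weylSystem_apply z ψ] with x hx
  rw [hx, RCLike.inner_apply, map_mul, map_mul, conj_cexp_I_mul_ofReal,
    show -(I / 2) * ((z.1 * z.2 : ℝ) : ℂ) = I * ((-(z.1 * z.2 / 2) : ℝ) : ℂ) by push_cast; ring,
    conj_cexp_I_mul_ofReal, neg_neg, translateMul]
  ring

/-- This form makes Plancherel available in the variable `p` at fixed `q`. -/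
theorem weylCoeff_eq_fourier (ψ φ : ConfL2) (z : ℝ × ℝ) :
    weylCoeff ψ φ z = cexp (I * (z.1 * z.2 / 2 : ℝ)) *
      𝓕 (fun x => translateMul ψ φ (z.1, x)) (z.2 / (2 * Real.pi)) := by
  rw [weylCoeff_eq_integral, Real.fourier_eq']
  congr 2
  ext x
  rw [smul_eq_mul, mul_comm I]
  congr 4
  have := Real.pi_ne_zero
  simp
  field_simp

theorem stronglyMeasurable_weylCoeff (ψ φ : ConfL2) : StronglyMeasurable (weylCoeff ψ φ) := by
  have h : weylCoeff ψ φ = fun z => cexp (I * (z.1 * z.2 / 2 : ℝ)) *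
      ∫ x, cexp (I * (-(z.2 * x) : ℝ)) * translateMul ψ φ (z.1, x) :=
    funext (weylCoeff_eq_integral ψ φ)
  rw [h]
  refine (by fun_prop : Continuous fun z : ℝ × ℝ =>
    cexp (I * (z.1 * z.2 / 2 : ℝ))).stronglyMeasurable.mul ?_
  refine StronglyMeasurable.integral_prod_right ?_
  have := measurable_translateMul ψ φ
  refine Measurable.stronglyMeasurable ?_
  unfold Function.uncurry
  fun_prop

/-- The squared modulus `|φ(x)|² |ψ(x - q)|²` is the integrand of the convolution of `|φ|²` with the
reflected `|ψ|²`, both integrable. -/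
theorem memLp_translateMul (ψ φ : ConfL2) :
    MemLp (translateMul ψ φ) 2 ((volume : Measure ℝ).prod volume) := by
  rw [memLp_two_iff_integrable_sq_norm (measurable_translateMul ψ φ).aestronglyMeasurable]
  have h1 := (memLp_two_iff_integrable_sq_norm (Lp.aestronglyMeasurable φ)).1 (Lp.memLp φ)
  have h2 := (memLp_two_iff_integrable_sq_norm (Lp.aestronglyMeasurable ψ)).1 (Lp.memLp ψ)
  refine (h1.convolution_integrand (ContinuousLinearMap.mul ℝ ℝ) h2.comp_neg).congr
    (Filter.Eventually.of_forall fun y => ?_)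
  simp [translateMul, mul_pow]

theorem ae_memLp_translateMul (ψ φ : ConfL2) :
    ∀ᵐ q : ℝ, MemLp (fun x => translateMul ψ φ (q, x)) 2 volume := by
  have h := memLp_translateMul ψ φ
  rw [memLp_two_iff_integrable_sq_norm h.aestronglyMeasurable] at h
  filter_upwards [h.prod_right_ae] with q hq
  exact (memLp_two_iff_integrable_sq_norm (integrable_translateMul ψ φ q).aestronglyMeasurable).2 hq

/-- Plancherel in `p`: the phases `e^{iqp/2}` cancel, and rescaling `p / 2π` gives the factor `2π`.
Only almost every `q` is reached, since the slices are known to lie in `L²` only almost everywhere.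
-/
theorem ae_integral_conj_weylCoeff_mul (φ₁ ψ₁ φ₂ ψ₂ : ConfL2) :
    ∀ᵐ q : ℝ, ∫ p, (starRingEnd ℂ) (weylCoeff ψ₁ φ₁ (q, p)) * weylCoeff ψ₂ φ₂ (q, p) =
      2 * Real.pi *
        ∫ x, (starRingEnd ℂ) (translateMul ψ₁ φ₁ (q, x)) * translateMul ψ₂ φ₂ (q, x) := by
  filter_upwards [ae_memLp_translateMul ψ₁ φ₁, ae_memLp_translateMul ψ₂ φ₂] with q h1 h2
  rw [← integral_conj_fourier_mul_fourier (integrable_translateMul ψ₁ φ₁ q) h1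
    (integrable_translateMul ψ₂ φ₂ q) h2]
  have h3 := Measure.integral_comp_div (fun p =>
    (starRingEnd ℂ) (𝓕 (fun x => translateMul ψ₁ φ₁ (q, x)) p) *
      𝓕 (fun x => translateMul ψ₂ φ₂ (q, x)) p) (2 * Real.pi)
  rw [abs_of_pos (by positivity), real_smul] at h3
  push_cast at h3
  rw [← h3]
  congr 1
  ext p
  rw [weylCoeff_eq_fourier, weylCoeff_eq_fourier, map_mul, mul_mul_mul_comm, conj_mul',
    norm_cexp_I_mul_ofReal]
  simp

theorem ae_integrable_norm_sq_weylCoeff (ψ φ : ConfL2) :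
    ∀ᵐ q : ℝ, Integrable fun p => ‖weylCoeff ψ φ (q, p)‖ ^ 2 := by
  filter_upwards [ae_memLp_translateMul ψ φ] with q hq
  have h1 := memLp_fourier (integrable_translateMul ψ φ q) hq
  rw [memLp_two_iff_integrable_sq_norm h1.aestronglyMeasurable] at h1
  refine (h1.comp_div (R := 2 * Real.pi) (by positivity)).congr
    (Filter.Eventually.of_forall fun p => ?_)
  simp only
  rw [weylCoeff_eq_fourier, norm_mul, norm_cexp_I_mul_ofReal, one_mul]

theorem ofReal_integral_norm_sq {α : Type*} [MeasurableSpace α] (μ : Measure α) (f : α → ℂ) :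
    ((∫ x, ‖f x‖ ^ 2 ∂μ : ℝ) : ℂ) = ∫ x, (starRingEnd ℂ) (f x) * f x ∂μ := by
  refine integral_complex_ofReal.symm.trans ?_
  congr 1
  ext x
  rw [conj_mul']
  push_cast
  rfl

theorem memLp_weylCoeff_volume (ψ φ : ConfL2) : MemLp (weylCoeff ψ φ) 2 volume := by
  have hm := (stronglyMeasurable_weylCoeff ψ φ).aestronglyMeasurable (μ := volume)
  rw [memLp_two_iff_integrable_sq_norm hm, Measure.volume_eq_prod,
    integrable_prod_iff (f := fun z => ‖weylCoeff ψ φ z‖ ^ 2) (hm.norm.pow 2)]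
  refine ⟨ae_integrable_norm_sq_weylCoeff ψ φ, ?_⟩
  have h := memLp_translateMul ψ φ
  rw [memLp_two_iff_integrable_sq_norm h.aestronglyMeasurable] at h
  -- The diagonal case of the Plancherel identity evaluates the inner integrals; they are integrable
  -- in `q` because `translateMul ψ φ` is square integrable.
  refine (h.integral_prod_left.const_mul (2 * Real.pi)).congr ?_
  filter_upwards [ae_integral_conj_weylCoeff_mul φ ψ φ ψ] with q hq
  rw [← ofReal_integral_norm_sq, ← ofReal_integral_norm_sq] at hq
  simp only [norm_pow, norm_norm]
  exact_mod_cast hq.symm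

theorem memLp_weylCoeff (ψ φ : ConfL2) : MemLp (weylCoeff ψ φ) 2 phaseMeasure :=
  memLp_phaseMeasure.2 (memLp_weylCoeff_volume ψ φ)

theorem integral_conj_translateMul_mul (φ₁ ψ₁ φ₂ ψ₂ : ConfL2) :
    ∫ q, ∫ x, (starRingEnd ℂ) (translateMul ψ₁ φ₁ (q, x)) * translateMul ψ₂ φ₂ (q, x) =
      ⟪φ₁, φ₂⟫_ℂ * ⟪ψ₂, ψ₁⟫_ℂ := by
  rw [integral_integral_swap
    (f := fun q x => (starRingEnd ℂ) (translateMul ψ₁ φ₁ (q, x)) * translateMul ψ₂ φ₂ (q, x))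
    ((memLp_translateMul ψ₁ φ₁).star.integrable_mul (memLp_translateMul ψ₂ φ₂)), L2.inner_def,
    L2.inner_def, ← integral_mul_const]
  congr 1
  ext x
  -- For fixed `x`, the reflected translation `y = x - q` separates the `ψ` factors from the `φ`
  -- factors.
  rw [← integral_sub_left_eq_self (fun y => ⟪ψ₂ y, ψ₁ y⟫_ℂ) volume x, ← integral_const_mul]
  congr 1
  ext q
  simp only [translateMul, RCLike.inner_apply, map_mul, conj_conj]
  ring

/-- The orthogonality relations of the Weyl system. -/
theorem integral_conj_weylCoeff_mul_weylCoeff (φ₁ ψ₁ φ₂ ψ₂ : ConfL2) :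
    ∫ z, (starRingEnd ℂ) (weylCoeff ψ₁ φ₁ z) * weylCoeff ψ₂ φ₂ z ∂phaseMeasure =
      ⟪φ₁, φ₂⟫_ℂ * ⟪ψ₂, ψ₁⟫_ℂ := by
  rw [integral_phaseMeasure, Measure.volume_eq_prod, integral_prod
    (fun z => (starRingEnd ℂ) (weylCoeff ψ₁ φ₁ z) * weylCoeff ψ₂ φ₂ z)
    ((memLp_weylCoeff_volume ψ₁ φ₁).star.integrable_mul (memLp_weylCoeff_volume ψ₂ φ₂)),
    integral_congr_ae (ae_integral_conj_weylCoeff_mul φ₁ ψ₁ φ₂ ψ₂), integral_const_mul,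
    integral_conj_translateMul_mul, ← mul_assoc]
  have := Real.pi_ne_zero
  field_simp

/-! ### The Wigner transform -/

/-- The coefficient function of the Weyl system as an element of `L²(ℝ × ℝ)`. -/
noncomputable def weylCoeffLp (ψ φ : ConfL2) : PhaseL2 := (memLp_weylCoeff ψ φ).toLp

theorem coeFn_weylCoeffLp (ψ φ : ConfL2) : weylCoeffLp ψ φ =ᵐ[phaseMeasure] weylCoeff ψ φ :=
  (memLp_weylCoeff ψ φ).coeFn_toLp

theorem inner_weylCoeffLp (φ₁ ψ₁ φ₂ ψ₂ : ConfL2) :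
    ⟪weylCoeffLp ψ₁ φ₁, weylCoeffLp ψ₂ φ₂⟫_ℂ = ⟪φ₁, φ₂⟫_ℂ * ⟪ψ₂, ψ₁⟫_ℂ := by
  rw [L2.inner_def, ← integral_conj_weylCoeff_mul_weylCoeff]
  refine integral_congr_ae ?_
  filter_upwards [coeFn_weylCoeffLp ψ₁ φ₁, coeFn_weylCoeffLp ψ₂ φ₂] with z h1 h2
  rw [h1, h2, RCLike.inner_apply, mul_comm]

/-- By the orthogonality relations the coefficient functions have the Gram matrix of the rank one
operators, among which there is a Hilbert basis. -/
theorem exists_isWignerTransform :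
    ∃ T : HilbertSchmidt ConfL2 →ₗᵢ[ℂ] PhaseL2, IsWignerTransform T.toContinuousLinearMap := by
  obtain ⟨v, hv⟩ := HilbertSchmidt.exists_hilbertBasis_rankOne (hsBasis ConfL2)
  obtain ⟨T, hT⟩ := exists_linearIsometry_of_inner_eq v
    (fun i => ((hsBasis ConfL2 i.1 : ConfL2), (hsBasis ConfL2 i.2 : ConfL2)))
    (r := fun y : ConfL2 × ConfL2 => HilbertSchmidt.rankOne y.1 y.2)
    (s := fun y => weylCoeffLp y.2 y.1) hv fun y y' => by
      rw [inner_weylCoeffLp, HilbertSchmidt.inner_rankOne_rankOne]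
  refine ⟨T, fun φ ψ => ?_⟩
  have h := hT (φ, ψ)
  simp only at h
  rw [LinearIsometry.coe_toContinuousLinearMap, h]
  exact coeFn_weylCoeffLp ψ φ

theorem IsWignerTransform.apply_rankOne {𝔖 : HilbertSchmidt ConfL2 →L[ℂ] PhaseL2}
    (h : IsWignerTransform 𝔖) (φ ψ : ConfL2) :
    𝔖 (HilbertSchmidt.rankOne φ ψ) = weylCoeffLp ψ φ :=
  Lp.ext ((h φ ψ).trans (coeFn_weylCoeffLp ψ φ).symm)

theorem IsWignerTransform.eq {𝔖 𝔖' : HilbertSchmidt ConfL2 →L[ℂ] PhaseL2}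
    (h : IsWignerTransform 𝔖) (h' : IsWignerTransform 𝔖') : 𝔖' = 𝔖 := by
  refine ContinuousLinearMap.ext_on HilbertSchmidt.dense_span_rankOne ?_
  rintro _ ⟨φ, ψ, rfl⟩
  rw [h.apply_rankOne, h'.apply_rankOne]

/-- The Gaussian `x ↦ e^{-x²/2}`. -/
noncomputable def gaussianFun (x : ℝ) : ℂ := cexp (-(1 / 2) * (x : ℂ) ^ 2)

theorem norm_gaussianFun (x : ℝ) : ‖gaussianFun x‖ = Real.exp (-(1 / 2) * x ^ 2) := by
  rw [gaussianFun, norm_exp]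
  congr 1
  rw [← ofReal_pow]
  simp [-ofReal_pow]

theorem memLp_gaussianFun : MemLp gaussianFun 2 volume := by
  have hc : Continuous gaussianFun := by unfold gaussianFun; fun_prop
  rw [memLp_two_iff_integrable_sq_norm hc.aestronglyMeasurable]
  refine (integrable_exp_neg_mul_sq one_pos).congr (Filter.Eventually.of_forall fun x => ?_)
  simp only [norm_gaussianFun]
  rw [← Real.exp_nat_mul]
  push_cast
  ring_nf

/-- Completing the square gives a nonzero constant times an exponential. -/
theorem weylCoeff_gaussian_ne_zero (z : ℝ × ℝ) :
    weylCoeff memLp_gaussianFun.toLp memLp_gaussianFun.toLp z ≠ 0 := by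
  rw [weylCoeff_eq_integral]
  refine mul_ne_zero (exp_ne_zero _) ?_
  have h : ∫ x, cexp (I * (-(z.2 * x) : ℝ)) *
      translateMul memLp_gaussianFun.toLp memLp_gaussianFun.toLp (z.1, x) =
      ∫ x : ℝ, cexp (-1 * (x : ℂ) ^ 2 + (z.1 - I * z.2) * x + -((z.1 : ℂ) ^ 2 / 2)) := by
    refine integral_congr_ae ?_
    filter_upwards [memLp_gaussianFun.coeFn_toLp, (eventually_sub_right_iff volume z.1).2
      memLp_gaussianFun.coeFn_toLp] with x h1 h2
    rw [translateMul, h1, h2, gaussianFun, gaussianFun, ← exp_conj, ← Complex.exp_add,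
      ← Complex.exp_add]
    congr 1
    simp only [map_mul, map_neg, map_div₀, map_one, map_ofNat, map_pow, conj_ofReal]
    push_cast
    ring
  rw [h, integral_cexp_quadratic (by simp)]
  refine mul_ne_zero ?_ (exp_ne_zero _)
  rw [Ne, cpow_eq_zero_iff]
  simp [Real.pi_ne_zero]

theorem eq_zero_of_inner_weylCoeffLp {f : PhaseL2}
    (h : ∀ φ ψ, ⟪f, weylCoeffLp ψ φ⟫_ℂ = 0) : f = 0 := by
  set g : ConfL2 := memLp_gaussianFun.toLp with hg
  have hi : Integrable (fun z => (starRingEnd ℂ) (f z) * weylCoeff g g z) volume :=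
    f.memLp.star.integrable_mul (memLp_weylCoeff_volume g g)
  have h0 : (fun z => (starRingEnd ℂ) (f z) * weylCoeff g g z) =ᵐ[volume] 0 := by
    refine ae_eq_zero_of_symplFourier_eq_zero hi fun w => ?_
    -- Shifting the Gaussian by `-w` modulates its coefficient by `e^{iσ(z,-w)} = e^{iσ(w,z)}`,
    -- which is exactly the Fourier kernel at `w`.
    rw [symplFourier, ← integral_phaseMeasure, ← h (weylSystem (-w) g) (weylSystem (-w) g),
      L2.inner_def]
    refine integral_congr_ae ?_
    filter_upwards [coeFn_weylCoeffLp (weylSystem (-w) g) (weylSystem (-w) g)] with z hz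
    rw [hz, weylCoeff_weylSystem, RCLike.inner_apply,
      show sympl z (-w) = sympl w z by simp [sympl]; ring]
    ring
  rw [Lp.eq_zero_iff_ae_eq_zero, ae_phaseMeasure]
  filter_upwards [h0] with z hz
  simpa using (mul_eq_zero.1 hz).resolve_right (weylCoeff_gaussian_ne_zero z)

/-- The range of an isometry of a complete space is closed, so a trivial orthogonal complement
suffices. -/
theorem IsWignerTransform.surjective {T : HilbertSchmidt ConfL2 →ₗᵢ[ℂ] PhaseL2}
    (hT : IsWignerTransform T.toContinuousLinearMap) : Function.Surjective T := by
  have hc : IsClosed (LinearMap.range T.toLinearMap : Set PhaseL2) :=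
    T.isometry.isClosedEmbedding.isClosed_range
  have : CompleteSpace (LinearMap.range T.toLinearMap) := hc.completeSpace_coe
  have h : (LinearMap.range T.toLinearMap)ᗮ = ⊥ := by
    rw [Submodule.eq_bot_iff]
    intro f hf
    refine eq_zero_of_inner_weylCoeffLp fun φ ψ => ?_
    rw [← hT.apply_rankOne]
    exact (Submodule.mem_orthogonal' _ _).1 hf _ ⟨_, rfl⟩
  rw [Submodule.orthogonal_eq_bot_iff] at h
  exact LinearMap.range_eq_top.1 h

end WeylSystem

/-! ### Pointwise formulas by density -/

section Density

/-- A bounded operator into `L²(ℝ × ℝ)` which on a total set is given by a family of bounded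
functionals is given by these functionals everywhere. -/
theorem ae_eq_of_dense_span {E : Type*} [NormedAddCommGroup E] [NormedSpace ℂ E]
    (T : E →L[ℂ] PhaseL2) (S : ℝ × ℝ → E →L[ℂ] ℂ) {s : Set E}
    (hs : Dense (Submodule.span ℂ s : Set E))
    (h : ∀ x ∈ s, T x =ᵐ[phaseMeasure] fun z => S z x) (x : E) :
    T x =ᵐ[phaseMeasure] fun z => S z x := by
  have hspan : ∀ x ∈ Submodule.span ℂ s, T x =ᵐ[phaseMeasure] fun z => S z x := by
    intro x hx
    induction hx using Submodule.span_induction with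
    | mem x hx => exact h x hx
    | zero =>
      rw [map_zero]
      filter_upwards [Lp.coeFn_zero ℂ 2 phaseMeasure] with z hz
      rw [hz, map_zero]
      rfl
    | add x y _ _ hx hy =>
      rw [map_add]
      filter_upwards [Lp.coeFn_add (T x) (T y), hx, hy] with z hz hx hy
      rw [hz, map_add, Pi.add_apply, hx, hy]
    | smul c x _ hx =>
      rw [map_smul]
      filter_upwards [Lp.coeFn_smul c (T x), hx] with z hz hx
      rw [hz, map_smul, Pi.smul_apply, hx]
  -- Convergence of `T (v n)` in `L²` gives convergence almost everywhere along a subsequence, while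
  -- `S z (v n)` converges for every `z`. No bound on `S z` uniform in `z` is needed.
  obtain ⟨v, hv, hlim⟩ := mem_closure_iff_seq_limit.1 (hs x)
  obtain ⟨k, hk, hae⟩ := (tendstoInMeasure_of_tendsto_Lp
    ((T.continuous.tendsto x).comp hlim)).exists_seq_tendsto_ae
  filter_upwards [hae, ae_all_iff.2 fun n => hspan (v n) (hv n)] with z hz hn
  refine tendsto_nhds_unique hz ?_
  have h2 := ((S z).continuous.tendsto x).comp (hlim.comp hk.tendsto_atTop)
  refine h2.congr fun n => ?_
  simp only [Function.comp_apply, hn]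

/-! ### Weighted composition operators in `L²(ℝ × ℝ)` -/

variable {u : ℝ × ℝ → ℂ} {θ : ℝ × ℝ → ℝ × ℝ} {c : ℝ≥0∞}

theorem quasiMeasurePreserving_phaseMeasure (hθ : Measurable θ)
    (hmap : Measure.map θ volume = c • volume) :
    Measure.QuasiMeasurePreserving θ phaseMeasure phaseMeasure := by
  refine ⟨hθ, ?_⟩
  rw [phaseMeasure, Measure.map_smul, hmap, smul_comm]
  exact Measure.smul_absolutelyContinuous

theorem eLpNorm_weightedComp (hu1 : ∀ w, ‖u w‖ = 1) (hθ : Measurable θ)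
    (hmap : Measure.map θ volume = c • volume) (f : PhaseL2) :
    eLpNorm (fun w => u w * f (θ w)) 2 phaseMeasure =
      c ^ (1 / 2 : ℝ≥0∞).toReal * eLpNorm f 2 phaseMeasure := by
  have h1 : eLpNorm (fun w => u w * f (θ w)) 2 phaseMeasure =
      eLpNorm (f ∘ θ) 2 phaseMeasure :=
    eLpNorm_congr_norm_ae (Filter.Eventually.of_forall fun w => by
      rw [norm_mul, hu1, one_mul, Function.comp_apply])
  have h2 : Measure.map θ phaseMeasure = c • phaseMeasure := by
    rw [phaseMeasure, Measure.map_smul, hmap, smul_comm]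
  rw [h1, ← eLpNorm_map_measure (Lp.stronglyMeasurable f).aestronglyMeasurable hθ.aemeasurable, h2]
  exact eLpNorm_smul_measure_of_ne_top (by simp) ..

theorem memLp_weightedComp (hu : Continuous u) (hu1 : ∀ w, ‖u w‖ = 1) (hθ : Measurable θ)
    (hmap : Measure.map θ volume = c • volume) (hc : c ≠ ∞) (f : PhaseL2) :
    MemLp (fun w => u w * f (θ w)) 2 phaseMeasure := by
  refine ⟨hu.aestronglyMeasurable.mul
    ((Lp.stronglyMeasurable f).comp_measurable hθ).aestronglyMeasurable, ?_⟩
  rw [eLpNorm_weightedComp hu1 hθ hmap]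
  exact ENNReal.mul_lt_top (ENNReal.rpow_lt_top_of_nonneg (by simp) hc) (Lp.memLp f).2

/-- The operator `f ↦ u · (f ∘ θ)` in `L²(ℝ × ℝ)`, where `u` is unimodular and `θ` scales the
measure. -/
noncomputable def weightedComp (hu : Continuous u) (hu1 : ∀ w, ‖u w‖ = 1) (hθ : Measurable θ)
    (hmap : Measure.map θ volume = c • volume) (hc : c ≠ ∞) : PhaseL2 →L[ℂ] PhaseL2 :=
  LinearMap.mkContinuous
    { toFun := fun f => (memLp_weightedComp hu hu1 hθ hmap hc f).toLp
      map_add' := fun f g => by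
        rw [← MemLp.toLp_add]
        refine MemLp.toLp_congr _ _ ?_
        filter_upwards [(quasiMeasurePreserving_phaseMeasure hθ hmap).ae_eq_comp
          (Lp.coeFn_add f g)] with w hw
        have hw : (f + g) (θ w) = f (θ w) + g (θ w) := hw
        rw [Pi.add_apply, hw, mul_add]
      map_smul' := fun a f => by
        rw [RingHom.id_apply, ← MemLp.toLp_const_smul]
        refine MemLp.toLp_congr _ _ ?_
        filter_upwards [(quasiMeasurePreserving_phaseMeasure hθ hmap).ae_eq_comp
          (Lp.coeFn_smul a f)] with w hw
        have hw : (a • f) (θ w) = a * f (θ w) := hw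
        rw [Pi.smul_apply, hw, smul_eq_mul]
        ring }
    (c ^ (1 / 2 : ℝ≥0∞).toReal).toReal fun f => by
      refine le_of_eq ?_
      change ‖(memLp_weightedComp hu hu1 hθ hmap hc f).toLp‖ = _
      rw [Lp.norm_toLp, eLpNorm_weightedComp hu1 hθ hmap, ENNReal.toReal_mul, Lp.norm_def]

theorem coeFn_weightedComp (hu : Continuous u) (hu1 : ∀ w, ‖u w‖ = 1) (hθ : Measurable θ)
    (hmap : Measure.map θ volume = c • volume) (hc : c ≠ ∞) (f : PhaseL2) :
    weightedComp hu hu1 hθ hmap hc f =ᵐ[phaseMeasure] fun w => u w * f (θ w) :=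
  (memLp_weightedComp hu hu1 hθ hmap hc f).coeFn_toLp

/-- The pairing of `L²` with itself is bounded by Cauchy–Schwarz. This supplies, at each point of
phase space, the functionals required by `ae_eq_of_dense_span`. -/
theorem exists_bilinear_weightedComp (hu : Continuous u) (hu1 : ∀ w, ‖u w‖ = 1)
    (hθ : Measurable θ) (hmap : Measure.map θ volume = c • volume) (hc : c ≠ ∞) :
    ∃ B : PhaseL2 →L[ℂ] PhaseL2 →L[ℂ] ℂ, ∀ f g,
      B f g = 1 / (2 * Real.pi) * ∫ w, f w * (u w * g (θ w)) := by
  refine ⟨((ContinuousLinearMap.mul ℂ ℂ).lpPairing phaseMeasure 2 2).bilinearComp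
    (ContinuousLinearMap.id ℂ PhaseL2) (weightedComp hu hu1 hθ hmap hc), fun f g => ?_⟩
  rw [ContinuousLinearMap.bilinearComp_apply, ContinuousLinearMap.lpPairing_eq_integral,
    ← integral_phaseMeasure]
  refine integral_congr_ae ?_
  filter_upwards [coeFn_weightedComp hu hu1 hθ hmap hc g] with w hw
  rw [hw]
  rfl

end Density

/-! ### The star product as twisted convolution -/

section StarProduct

theorem norm_cexp_half_sympl (z w : ℝ × ℝ) : ‖cexp (I / 2 * sympl z w)‖ = 1 := by
  rw [show I / 2 * (sympl z w : ℂ) = I * ((sympl z w / 2 : ℝ) : ℂ) by push_cast; ring,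
    norm_cexp_I_mul_ofReal]

theorem map_sub_left_volume (z : ℝ × ℝ) :
    Measure.map (fun w => z - w) (volume : Measure (ℝ × ℝ)) = (1 : ℝ≥0∞) • volume := by
  rw [(Measure.measurePreserving_sub_left volume z).map_eq, one_smul]

/-- The twisted convolution of two functions on phase space. -/
noncomputable def twistedConv (f g : ℝ × ℝ → ℂ) (z : ℝ × ℝ) : ℂ :=
  1 / (2 * Real.pi) * ∫ w, f w * g (z - w) * cexp (I / 2 * sympl z w)

theorem integrable_twistedConv (f g : PhaseL2) (z : ℝ × ℝ) :
    Integrable (fun w : ℝ × ℝ => f w * g (z - w) * cexp (I / 2 * sympl z w)) volume := by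
  have h : MemLp (fun w => cexp (I / 2 * sympl z w) * g (z - w)) 2 (volume : Measure (ℝ × ℝ)) :=
    memLp_phaseMeasure.1 (memLp_weightedComp (by fun_prop) (norm_cexp_half_sympl z)
      (by fun_prop) (map_sub_left_volume z) (by simp) g)
  refine (f.memLp.integrable_mul h).congr (Filter.Eventually.of_forall fun w => ?_)
  simp only [Pi.mul_apply]
  ring

theorem exists_bilinear_twistedConv (z : ℝ × ℝ) :
    ∃ B : PhaseL2 →L[ℂ] PhaseL2 →L[ℂ] ℂ, ∀ f g : PhaseL2, B f g = twistedConv f g z := by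
  obtain ⟨B, hB⟩ := exists_bilinear_weightedComp (u := fun w => cexp (I / 2 * sympl z w))
    (by fun_prop) (norm_cexp_half_sympl z) (by fun_prop) (map_sub_left_volume z) (by simp)
  refine ⟨B, fun f g => ?_⟩
  rw [hB, twistedConv]
  congr 2
  ext w
  ring

theorem weylSystem_sub (z w : ℝ × ℝ) :
    weylSystem (z - w) = cexp (I / 2 * sympl z w) •
      (ContinuousLinearMap.adjoint (weylSystem w) ∘L weylSystem z) := by
  rw [adjoint_weylSystem, show z - w = -w + z by abel, weylSystem_add,
    show sympl (-w) z = sympl z w by simp [sympl]; ring]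

/-- Since `U(z - w)` is a phase times `U(w)* U(z)`, the second coefficient becomes the conjugate of
`⟪U(w)φ₂, U(z)ψ₂⟫` times a phase that cancels the twist. What remains is an orthogonality integral
in `w`. -/
theorem twistedConv_weylCoeff (φ₁ ψ₁ φ₂ ψ₂ : ConfL2) (z : ℝ × ℝ) :
    twistedConv (weylCoeff ψ₁ φ₁) (weylCoeff ψ₂ φ₂) z = ⟪ψ₁, φ₂⟫_ℂ * weylCoeff ψ₂ φ₁ z := by
  have h : ∀ w, weylCoeff ψ₁ φ₁ w * weylCoeff ψ₂ φ₂ (z - w) * cexp (I / 2 * sympl z w) =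
      (starRingEnd ℂ) (weylCoeff φ₂ (weylSystem z ψ₂) w) * weylCoeff ψ₁ φ₁ w := by
    intro w
    rw [weylCoeff, weylCoeff, weylCoeff, weylSystem_sub, smul_apply, inner_smul_left,
      ContinuousLinearMap.comp_apply, ContinuousLinearMap.adjoint_inner_left, inner_conj_symm,
      show I / 2 * (sympl z w : ℂ) = I * ((sympl z w / 2 : ℝ) : ℂ) by push_cast; ring]
    have h1 := conj_mul' (cexp (I * ((sympl z w / 2 : ℝ) : ℂ)))
    rw [norm_cexp_I_mul_ofReal, ofReal_one, one_pow] at h1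
    linear_combination (⟪weylSystem w ψ₁, φ₁⟫_ℂ * ⟪weylSystem z ψ₂, weylSystem w φ₂⟫_ℂ) * h1
  rw [twistedConv, ← integral_phaseMeasure]
  simp only [h]
  rw [integral_conj_weylCoeff_mul_weylCoeff, mul_comm]
  rfl

theorem twistedConv_congr {f f' g g' : ℝ × ℝ → ℂ} (hf : f =ᵐ[volume] f') (hg : g =ᵐ[volume] g') :
    twistedConv f g = twistedConv f' g' := by
  ext z
  rw [twistedConv, twistedConv]
  congr 1
  refine integral_congr_ae ?_
  filter_upwards [hf, (Measure.measurePreserving_sub_left volume z).quasiMeasurePreserving.ae_eq_comp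
    hg] with w h1 h2
  have h2 : g (z - w) = g' (z - w) := h2
  rw [h1, h2]

/-- The Wigner transform turns composition into twisted convolution. -/
theorem IsWignerTransform.apply_comp {𝔖 : HilbertSchmidt ConfL2 →L[ℂ] PhaseL2}
    (h : IsWignerTransform 𝔖) (A B : HilbertSchmidt ConfL2) :
    𝔖 (HilbertSchmidt.comp A B) =ᵐ[phaseMeasure] twistedConv (𝔖 A) (𝔖 B) := by
  choose D hD using exists_bilinear_twistedConv
  -- Density is used one variable at a time: first in `B` with `A` arbitrary, then in `A` with `B`
  -- of rank one.
  have key := ae_eq_of_dense_span (𝔖 ∘L HilbertSchmidt.compL A) (fun z => D z (𝔖 A) ∘L 𝔖)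
    HilbertSchmidt.dense_span_rankOne ?_ B
  · refine key.trans (Filter.Eventually.of_forall fun z => ?_)
    exact hD z _ _
  rintro _ ⟨φ₂, ψ₂, rfl⟩
  refine ae_eq_of_dense_span (𝔖 ∘L HilbertSchmidt.compL.flip (HilbertSchmidt.rankOne φ₂ ψ₂))
    (fun z => (D z).flip (𝔖 (HilbertSchmidt.rankOne φ₂ ψ₂)) ∘L 𝔖)
    HilbertSchmidt.dense_span_rankOne ?_ A
  rintro _ ⟨φ₁, ψ₁, rfl⟩
  have e1 : (𝔖 ∘L HilbertSchmidt.compL.flip (HilbertSchmidt.rankOne φ₂ ψ₂))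
      (HilbertSchmidt.rankOne φ₁ ψ₁) = ⟪ψ₁, φ₂⟫_ℂ • weylCoeffLp ψ₂ φ₁ := by
    rw [ContinuousLinearMap.comp_apply, ContinuousLinearMap.flip_apply, HilbertSchmidt.compL_apply,
      HilbertSchmidt.rankOne_comp_rankOne, map_smul, h.apply_rankOne]
  rw [e1]
  filter_upwards [Lp.coeFn_smul ⟪ψ₁, φ₂⟫_ℂ (weylCoeffLp ψ₂ φ₁), coeFn_weylCoeffLp ψ₂ φ₁]
    with z h1 h2
  rw [h1, Pi.smul_apply, h2, smul_eq_mul, ← twistedConv_weylCoeff]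
  refine Eq.trans ?_ (hD z _ _).symm
  have h3 := h φ₁ ψ₁
  have h4 := h φ₂ ψ₂
  rw [ae_phaseMeasure] at h3 h4
  exact congrFun (twistedConv_congr h3 h4).symm z

theorem IsWignerTransform.inducedProduct_ae_eq {T : HilbertSchmidt ConfL2 →ₗᵢ[ℂ] PhaseL2}
    (hT : IsWignerTransform T.toContinuousLinearMap) (f g : PhaseL2) :
    inducedProduct T.toContinuousLinearMap f g =ᵐ[phaseMeasure] twistedConv f g := by
  -- A surjective isometry satisfies `T T* = 1`.
  have hadj : ∀ f, T.toContinuousLinearMap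
      (ContinuousLinearMap.adjoint T.toContinuousLinearMap f) = f := fun f => by
    obtain ⟨A, rfl⟩ := hT.surjective f
    exact congrArg T (DFunLike.congr_fun
      ((ContinuousLinearMap.norm_map_iff_adjoint_comp_self T.toContinuousLinearMap).1 T.norm_map) A)
  have h := hT.apply_comp (ContinuousLinearMap.adjoint T.toContinuousLinearMap f)
    (ContinuousLinearMap.adjoint T.toContinuousLinearMap g)
  rwa [hadj, hadj] at h

end StarProduct

/-! ### The twisted product and the Grönewold–Moyal kernel -/

section TwistedProduct

theorem map_add_half_smul_volume (z : ℝ × ℝ) :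
    Measure.map (fun v => z + (2⁻¹ : ℝ) • v) (volume : Measure (ℝ × ℝ)) =
      (4 : ℝ≥0∞) • volume := by
  have h : (fun v : ℝ × ℝ => z + (2⁻¹ : ℝ) • v) = (fun v => z + v) ∘ fun v => (2⁻¹ : ℝ) • v := rfl
  rw [h, ← Measure.map_map (measurable_const_add z) (measurable_const_smul _),
    Measure.map_addHaar_smul _ (by norm_num), Measure.map_smul, map_add_left_eq_self,
    Module.finrank_prod, Module.finrank_self]
  congr 1
  norm_num

/-- The right side of `symplFourier_twistedConv`, with `f` standing for a Fourier transform, is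
bounded on `L² × L²` at each `z`; this permits its extension by density. -/
theorem exists_bilinear_add_half_smul (z : ℝ × ℝ) :
    ∃ B : PhaseL2 →L[ℂ] PhaseL2 →L[ℂ] ℂ, ∀ f g : PhaseL2, B f g =
      1 / (2 * Real.pi) * ∫ v, g v * (cexp (I * sympl z v) * f (z + (2⁻¹ : ℝ) • v)) := by
  obtain ⟨B, hB⟩ := exists_bilinear_weightedComp (u := fun w => cexp (I * sympl z w))
    (by fun_prop) (fun w => norm_cexp_I_mul_ofReal _) (by fun_prop) (map_add_half_smul_volume z)
    (by simp)
  exact ⟨B.flip, fun f g => hB g f⟩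

theorem integrable_prod_twistedConv {f g : ℝ × ℝ → ℂ} (hf : Integrable f) (hg : Integrable g)
    {k : (ℝ × ℝ) × (ℝ × ℝ) → ℂ} (hk : Continuous k) (hk1 : ∀ y, ‖k y‖ = 1) :
    Integrable (fun y : (ℝ × ℝ) × (ℝ × ℝ) => f y.2 * g (y.1 - y.2) * k y)
      ((volume : Measure (ℝ × ℝ)).prod volume) :=
  (hf.convolution_integrand (ContinuousLinearMap.mul ℂ ℂ) hg).mul_bdd (c := 1)
    hk.aestronglyMeasurable (Filter.Eventually.of_forall fun y => (hk1 y).le)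

theorem integrable_twistedConv_of_integrable {f g : ℝ × ℝ → ℂ} (hf : Integrable f)
    (hg : Integrable g) : Integrable (twistedConv f g) :=
  (integrable_prod_twistedConv hf hg (k := fun y => cexp (I / 2 * sympl y.1 y.2)) (by fun_prop)
    fun y => norm_cexp_half_sympl _ _).integral_prod_left.const_mul _

/-- The symplectic Fourier transform of a twisted convolution. -/
theorem symplFourier_twistedConv {f g : ℝ × ℝ → ℂ} (hf : Integrable f) (hg : Integrable g)
    (z : ℝ × ℝ) :
    symplFourier (twistedConv f g) z = 1 / (2 * Real.pi) *
      ∫ v, g v * (cexp (I * sympl z v) * symplFourier f (z + (2⁻¹ : ℝ) • v)) := by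
  have hπ := Real.pi_ne_zero
  have e1 : ∫ y, twistedConv f g y * cexp (I * sympl z y) = 1 / (2 * Real.pi) *
      ∫ y, ∫ w, f w * g (y - w) * cexp (I * (sympl y w / 2 + sympl z y : ℝ)) := by
    rw [← integral_const_mul]
    congr 1
    ext y
    rw [twistedConv, mul_assoc, ← integral_mul_const]
    congr 2
    ext w
    rw [mul_assoc, ← Complex.exp_add]
    congr 2
    push_cast
    ring
  -- After Fubini, substitute `y = v + w`; `σ(w, w) = 0` leaves `σ(v, w) / 2` in the twist.
  have e2 : ∫ y, ∫ w, f w * g (y - w) * cexp (I * (sympl y w / 2 + sympl z y : ℝ)) =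
      ∫ w, ∫ v, cexp (I * (sympl v w / 2 + sympl z v + sympl z w : ℝ)) * (f w * g v) := by
    rw [integral_integral_swap (f := fun y w =>
      f w * g (y - w) * cexp (I * (sympl y w / 2 + sympl z y : ℝ)))
      (integrable_prod_twistedConv hf hg
        (k := fun y => cexp (I * (sympl y.1 y.2 / 2 + sympl z y.1 : ℝ))) (by fun_prop)
        fun y => norm_cexp_I_mul_ofReal _)]
    congr 1
    ext w
    rw [← integral_add_right_eq_self _ w]
    congr 1
    ext v
    rw [add_sub_cancel_right, mul_comm]
    congr 4
    simp only [sympl, Prod.fst_add, Prod.snd_add]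
    ring
  -- Since `σ(v,w)/2 + σ(z,w) = σ(z + v/2, w)`, the `w` integral is the Fourier integral of `f` at
  -- `z + v/2`.
  have e3 : ∫ w, ∫ v, cexp (I * (sympl v w / 2 + sympl z v + sympl z w : ℝ)) * (f w * g v) =
      (2 * Real.pi) *
        ∫ v, g v * (cexp (I * sympl z v) * symplFourier f (z + (2⁻¹ : ℝ) • v)) := by
    rw [integral_integral_swap (f := fun w v =>
      cexp (I * (sympl v w / 2 + sympl z v + sympl z w : ℝ)) * (f w * g v))
      (integrable_unimodular_mul
        (k := fun y => cexp (I * (sympl y.2 y.1 / 2 + sympl z y.2 + sympl z y.1 : ℝ)))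
        (by fun_prop) (fun y => norm_cexp_I_mul_ofReal _) hf hg), ← integral_const_mul]
    congr 1
    ext v
    rw [symplFourier, ← integral_const_mul, ← integral_const_mul, ← integral_const_mul,
      ← integral_const_mul]
    congr 1
    ext w
    have h : cexp (I * (sympl v w / 2 + sympl z v + sympl z w : ℝ)) =
        cexp (I * sympl z v) * cexp (I * sympl (z + (2⁻¹ : ℝ) • v) w) := by
      rw [← Complex.exp_add]
      congr 1
      simp only [sympl, Prod.fst_add, Prod.snd_add, Prod.smul_fst, Prod.smul_snd, smul_eq_mul]
      push_cast
      ring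
    rw [h]
    field_simp
  rw [symplFourier, e1, e2, e3]
  field_simp

theorem IsWignerTransform.symplFourierL_inducedProduct_ae_eq
    {T : HilbertSchmidt ConfL2 →ₗᵢ[ℂ] PhaseL2}
    (hT : IsWignerTransform T.toContinuousLinearMap) (f g : PhaseL2) :
    symplFourierL (inducedProduct T.toContinuousLinearMap (symplFourierL f) g) =ᵐ[phaseMeasure]
      fun z => 1 / (2 * Real.pi) *
        ∫ v, g v * (cexp (I * sympl z v) * f (z + (2⁻¹ : ℝ) • v)) := by
  choose D hD using exists_bilinear_add_half_smul
  set 𝔖 := T.toContinuousLinearMap with h𝔖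
  let P : PhaseL2 →L[ℂ] PhaseL2 →L[ℂ] HilbertSchmidt ConfL2 :=
    HilbertSchmidt.compL.bilinearComp (ContinuousLinearMap.adjoint 𝔖)
      (ContinuousLinearMap.adjoint 𝔖)
  have hP : ∀ f g, 𝔖 (P f g) = inducedProduct 𝔖 f g := fun f g => rfl
  have key := ae_eq_of_dense_span (symplFourierL ∘L 𝔖 ∘L P (symplFourierL f)) (fun z => D z f)
    (s := (integrableSubmodule : Set PhaseL2))
    (by rw [Submodule.span_eq]; exact dense_integrableSubmodule) ?_ g
  · exact key.trans (Filter.Eventually.of_forall fun z => hD z f g)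
  intro g hg
  -- With `g` now integrable, `f` runs through the `𝓕`-image of `L¹ ∩ L²`, dense because `𝓕` is a
  -- continuous surjection. There `𝓕 f` is integrable too, so the `L¹` formula applies.
  refine ae_eq_of_dense_span (symplFourierL ∘L 𝔖 ∘L P.flip g ∘L symplFourierL)
    (fun z => (D z).flip g) (s := symplFourierL '' (integrableSubmodule : Set PhaseL2))
    ?_ ?_ f
  · refine Dense.mono Submodule.subset_span ?_
    refine DenseRange.dense_image ?_ symplFourierL.continuous dense_integrableSubmodule
    exact Function.Surjective.denseRange fun x => ⟨_, symplFourierL_symplFourierL x⟩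
  · rintro _ ⟨f, hf, rfl⟩
    have h1 : (symplFourierL ∘L 𝔖 ∘L P.flip g ∘L symplFourierL) (symplFourierL f) =
        symplFourierL (inducedProduct 𝔖 f g) := by
      simp only [ContinuousLinearMap.comp_apply, ContinuousLinearMap.flip_apply,
        symplFourierL_symplFourierL, hP]
    have h2 := hT.inducedProduct_ae_eq f g
    rw [ae_phaseMeasure] at h2
    have h3 : Integrable (inducedProduct 𝔖 f g) (volume : Measure (ℝ × ℝ)) :=
      (integrable_twistedConv_of_integrable hf hg).congr h2.symm
    have h4 := isSymplecticFourier_symplFourierL _ h3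
    rw [h1]
    refine h4.trans (Filter.Eventually.of_forall fun z => ?_)
    change symplFourier (inducedProduct 𝔖 f g) z = D z (symplFourierL f) g
    rw [symplFourier_congr h2, symplFourier_twistedConv hf hg, hD]
    congr 1
    refine integral_congr_ae ?_
    have h5 := (quasiMeasurePreserving_phaseMeasure (by fun_prop)
      (map_add_half_smul_volume z)).ae_eq_comp (isSymplecticFourier_symplFourierL f hf)
    rw [ae_phaseMeasure] at h5
    filter_upwards [h5] with v hv
    have hv : symplFourierL f (z + (2⁻¹ : ℝ) • v) = symplFourier f (z + (2⁻¹ : ℝ) • v) := hv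
    rw [hv]

theorem inducedProduct_comp_symplFourierL (𝔖 : HilbertSchmidt ConfL2 →L[ℂ] PhaseL2)
    (f g : PhaseL2) :
    inducedProduct (symplFourierL ∘L 𝔖) f g =
      symplFourierL (inducedProduct 𝔖 (symplFourierL f) (symplFourierL g)) := by
  have h : ContinuousLinearMap.adjoint symplFourierL = symplFourierL := by
    rw [← ContinuousLinearMap.star_eq_adjoint, isSelfAdjoint_symplFourierL.star_eq]
  rw [inducedProduct, ContinuousLinearMap.adjoint_comp, h]
  rfl

theorem moyalKernel_eq (z a b : ℝ × ℝ) :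
    moyalKernel z a b = cexp (I * (2 * (sympl z a + sympl a b + sympl b z) : ℝ)) := by
  rw [moyalKernel]
  congr 1
  simp only [sympl]
  push_cast
  ring

theorem integrable_moyalKernel {f g : ℝ × ℝ → ℂ} (hf : Integrable f) (hg : Integrable g)
    (z : ℝ × ℝ) :
    Integrable (fun y : (ℝ × ℝ) × (ℝ × ℝ) => moyalKernel z y.1 y.2 * f y.1 * g y.2)
      (volume.prod volume) := by
  refine (integrable_unimodular_mul (k := fun y => moyalKernel z y.1 y.2) ?_ (fun y => ?_)
    hf hg).congr (Filter.Eventually.of_forall fun y => (mul_assoc _ _ _).symm)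
  · simp only [moyalKernel_eq]
    fun_prop
  · rw [moyalKernel_eq, norm_cexp_I_mul_ofReal]

/-- With `v = 2(a - z)` the phases combine: `σ(v,b) + σ(z,v) = 2(σ(z,a) + σ(a,b) + σ(b,z))`. The
Jacobian `4` and two prefactors `1 / 2π` give `1 / π²`. The `a` integral stays outermost, so no
exchange of integrals occurs. -/
theorem integral_symplFourier_mul_eq_moyal (f g : ℝ × ℝ → ℂ) (z : ℝ × ℝ) :
    1 / (2 * Real.pi) * ∫ v, symplFourier g v * (cexp (I * sympl z v) * f (z + (2⁻¹ : ℝ) • v)) =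
      1 / (Real.pi : ℂ) ^ 2 * ∫ a, ∫ b, moyalKernel z a b * f a * g b := by
  have hπ := Real.pi_ne_zero
  have h1 := Measure.integral_comp_smul (volume : Measure (ℝ × ℝ)) (fun v =>
    symplFourier g v * (cexp (I * sympl z v) * f (z + (2⁻¹ : ℝ) • v))) 2
  rw [Module.finrank_prod, Module.finrank_self,
    ← integral_sub_right_eq_self _ z, real_smul] at h1
  have h2 : ∀ a, symplFourier g ((2 : ℝ) • (a - z)) * (cexp (I * sympl z ((2 : ℝ) • (a - z))) *
      f (z + (2⁻¹ : ℝ) • (2 : ℝ) • (a - z))) =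
      1 / (2 * Real.pi) * ∫ b, moyalKernel z a b * f a * g b := by
    intro a
    rw [smul_smul, inv_mul_cancel₀ two_ne_zero, one_smul, add_sub_cancel, symplFourier, mul_assoc,
      ← integral_mul_const]
    congr 2
    ext b
    have h3 : moyalKernel z a b = cexp (I * sympl ((2 : ℝ) • (a - z)) b) *
        cexp (I * sympl z ((2 : ℝ) • (a - z))) := by
      rw [moyalKernel_eq, ← Complex.exp_add]
      congr 1
      simp only [sympl, Prod.fst_sub, Prod.snd_sub, Prod.smul_fst, Prod.smul_snd, smul_eq_mul]
      push_cast
      ring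
    rw [h3]
    ring
  simp only [h2] at h1
  rw [integral_const_mul] at h1
  have h4 : ((|(2 ^ (1 + 1) : ℝ)⁻¹| : ℝ) : ℂ) = 1 / 4 := by
    rw [abs_of_pos (by positivity)]
    push_cast
    norm_num
  rw [h4] at h1
  have h5 : ∫ v, symplFourier g v * (cexp (I * sympl z v) * f (z + (2⁻¹ : ℝ) • v)) =
      4 * (1 / (2 * Real.pi) * ∫ a, ∫ b, moyalKernel z a b * f a * g b) := by
    rw [h1]
    ring
  rw [h5]
  field_simp
  norm_num

theorem IsWignerTransform.inducedProduct_moyal {T : HilbertSchmidt ConfL2 →ₗᵢ[ℂ] PhaseL2}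
    (hT : IsWignerTransform T.toContinuousLinearMap) (f : PhaseL2) {g : PhaseL2}
    (hg : Integrable g (volume : Measure (ℝ × ℝ))) :
    inducedProduct (symplFourierL ∘L T.toContinuousLinearMap) f g =ᵐ[phaseMeasure] fun z =>
      1 / (Real.pi : ℂ) ^ 2 * ∫ a, ∫ b, moyalKernel z a b * f a * g b := by
  rw [inducedProduct_comp_symplFourierL]
  refine (hT.symplFourierL_inducedProduct_ae_eq f (symplFourierL g)).trans
    (Filter.Eventually.of_forall fun z => ?_)
  simp only
  rw [← integral_symplFourier_mul_eq_moyal]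
  congr 1
  refine integral_congr_ae ?_
  have h := isSymplecticFourier_symplFourierL g hg
  rw [ae_phaseMeasure] at h
  filter_upwards [h] with v hv
  rw [hv, symplFourier]

end TwistedProduct

theorem mainTheorem12 :
    -- the Weyl system is a projective unitary representation, square integrable with
    -- Duflo-Moore operator `1` for the Haar measure `(2π)⁻¹ dq dp`
    (∀ z : ℝ × ℝ, weylSystem z ∈ unitary (ConfL2 →L[ℂ] ConfL2)) ∧
    (∀ z w : ℝ × ℝ, weylSystem (z + w) =
      cexp (I / 2 * sympl z w) • (weylSystem z ∘L weylSystem w)) ∧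
    (∀ φ ψ : ConfL2, MemLp (weylCoeff ψ φ) 2 phaseMeasure) ∧
    (∀ φ₁ ψ₁ φ₂ ψ₂ : ConfL2,
      ∫ z, (starRingEnd ℂ) (weylCoeff ψ₁ φ₁ z) * weylCoeff ψ₂ φ₂ z ∂phaseMeasure =
        ⟪φ₁, φ₂⟫_ℂ * ⟪ψ₂, ψ₁⟫_ℂ) ∧
    ∃ (𝔖 : HilbertSchmidt ConfL2 →L[ℂ] PhaseL2) (𝓕 : PhaseL2 →L[ℂ] PhaseL2),
      -- `𝔖` is the Wigner transform of the Weyl system; it is isometric with range `L²(ℝ × ℝ)`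
      (IsWignerTransform 𝔖 ∧ ∀ 𝔖', IsWignerTransform 𝔖' → 𝔖' = 𝔖) ∧
      Isometry 𝔖 ∧ Set.range 𝔖 = Set.univ ∧
      -- `𝓕` is the symplectic Fourier transform; it is unitary and selfadjoint
      (IsSymplecticFourier 𝓕 ∧ ∀ 𝓕', IsSymplecticFourier 𝓕' → 𝓕' = 𝓕) ∧
      𝓕 ∈ unitary (PhaseL2 →L[ℂ] PhaseL2) ∧ IsSelfAdjoint 𝓕 ∧
      -- the star product of the Weyl system is the twisted convolution
      (∀ f₁ f₂ : PhaseL2,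
        (∀ z : ℝ × ℝ, Integrable
          (fun w : ℝ × ℝ => f₁ w * f₂ (z - w) * cexp (I / 2 * sympl z w)) volume) ∧
        inducedProduct 𝔖 f₁ f₂ =ᵐ[phaseMeasure] fun z =>
          1 / (2 * Real.pi) * ∫ w, f₁ w * f₂ (z - w) * cexp (I / 2 * sympl z w)) ∧
      -- the twisted product, induced by the standard Wigner transform `𝓕 𝔖`, is the star
      -- product conjugated by `𝓕`
      (∀ f₁ f₂ : PhaseL2,
        inducedProduct (𝓕 ∘L 𝔖) f₁ f₂ = 𝓕 (inducedProduct 𝔖 (𝓕 f₁) (𝓕 f₂))) ∧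
      -- the twisted product has the Grönewold-Moyal kernel on `L¹ ∩ L²`
      (∀ f₁ f₂ : PhaseL2, Integrable f₁ volume → Integrable f₂ volume →
        (∀ z : ℝ × ℝ, Integrable (fun y : (ℝ × ℝ) × (ℝ × ℝ) =>
          moyalKernel z y.1 y.2 * f₁ y.1 * f₂ y.2) (volume.prod volume)) ∧
        inducedProduct (𝓕 ∘L 𝔖) f₁ f₂ =ᵐ[phaseMeasure] fun z =>
          1 / (Real.pi : ℂ) ^ 2 *
            ∫ z' : ℝ × ℝ, ∫ z'' : ℝ × ℝ, moyalKernel z z' z'' * f₁ z' * f₂ z'') := by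
  obtain ⟨T, hT⟩ := exists_isWignerTransform
  refine ⟨weylSystem_mem_unitary, weylSystem_add, fun φ ψ => memLp_weylCoeff ψ φ,
    integral_conj_weylCoeff_mul_weylCoeff, T.toContinuousLinearMap, symplFourierL,
    ⟨hT, fun _ h => hT.eq h⟩, T.isometry, hT.surjective.range_eq,
    ⟨isSymplecticFourier_symplFourierL, fun _ h => h.eq⟩, symplFourierL_mem_unitary,
    isSelfAdjoint_symplFourierL, fun f₁ f₂ => ⟨integrable_twistedConv f₁ f₂, ?_⟩,
    inducedProduct_comp_symplFourierL _,
    fun f₁ f₂ h₁ h₂ => ⟨integrable_moyalKernel h₁ h₂, hT.inducedProduct_moyal f₁ h₂⟩⟩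
  exact hT.inducedProduct_ae_eq f₁ f₂
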